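/- Let $p$ be a prime and let $(L,q)$ be a (non-degenerate) $\mathbb{Z}_p$-lattice, i.e. a finitely generated free $\mathbb{Z}_p$-module $L$ with a quadratic form $q\colon L\to\mathbb{Q}_p$ whose bilinear form $b(x,y)=q(x+y)-q(x)-q(y)$ is non-degenerate. Let $O(L,q)$ be the group of $\mathbb{Z}_p$-linear automorphisms of $L$ preserving $q$, and $L^\vee=\{x\in L\otimes\mathbb{Q}_p \mid b(x,L)\subseteq\mathbb{Z}_p\}$. A Jordan decomposition $(L,q)=\bigoplus_{i\in\mathbb{Z}}(L_i,p^iq_i)$ is an orthogonal decomposition in which every $(L_i,q_i)$ is unimodular, i.e. its bilinear form $b_i$ is $\mathbb{Z}_p$-valued with Gram determinant a unit. The lattice $(L_i,q_i)$ is even if $b_i(x,x)\in 2\mathbb{Z}_p$ for all $x\in L_i$ (so the zero lattice is even). The constituent $L_i$ is called free if both $(L_{i-1},q_{i-1})$ and $(L_{i+1},q_{i+1})$ are even, and bound otherwise; this does not depend on the chosen Jordan decomposition. For $i\in\mathbb{Z}$ put \[ H_i=(p^iL^\vee\cap L)+pL,\qquad \rho_i(L)=H_i/H_{i+1}. \]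 Every class in $\rho_i(L)$ has a representative in $p^iL^\vee\cap L$, and $\rho_i(L)$ carries the well-defined $\mathbb{Q}_p/p\mathbb{Z}_p$-valued symmetric bilinear form \[ \bar b_i(x+H_{i+1},y+H_{i+1})=p^{-i}b(x,y)\bmod p\qquad(x,y\in p^iL^\vee\cap L). \] If $L_i$ is free, it also carries the well-defined $\mathbb{Q}_p/p\mathbb{Z}_p$-valued quadratic form \[ \bar q_i(x+H_{i+1})=p^{-i}q(x)\bmod p\qquad(x\in p^iL^\vee\cap L). \] Let $O(\rho_i(L))$ be the group of linear automorphisms of $\rho_i(L)$ preserving $\bar q_i$ if $L_i$ is free, and preserving $\bar b_i$ if $L_i$ is bound. Then the natural homomorphism \[ O(L,q)\longrightarrow\prod_{i\in\mathbb{Z}}O(\rho_i(L)) \] is surjective. -/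

import Mathlib

open Module
open scoped TensorProduct Pointwise

namespace PadicLattice

noncomputable section

/-! ### Orthogonal groups of forms with values in a module -/

/-- The orthogonal group `O(q)` of an `F`-valued quadratic form over `R`. -/
def quadOrthogonalGroup {R L F : Type*} [CommRing R] [AddCommGroup L] [Module R L]
    [AddCommGroup F] [Module R F] (q : QuadraticMap R L F) : Subgroup (L ≃ₗ[R] L) where
  carrier := {f | ∀ x, q (f x) = q x}
  one_mem' := fun _ => rfl
  mul_mem' := fun {f g} hf hg x => (hf (g x)).trans (hg x)
  inv_mem' := fun {f} hf x => by
    have h := hf (f⁻¹ x)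
    rw [← LinearEquiv.mul_apply, mul_inv_cancel] at h
    exact h.symm

/-- The orthogonal group `O(b)` of an `F`-valued bilinear form over `R`. -/
def bilinOrthogonalGroup {R L F : Type*} [CommRing R] [AddCommGroup L] [Module R L]
    [AddCommGroup F] [Module R F] (b : LinearMap.BilinMap R L F) : Subgroup (L ≃ₗ[R] L) where
  carrier := {f | ∀ x y, b (f x) (f y) = b x y}
  one_mem' := fun _ _ => rfl
  mul_mem' := fun {f g} hf hg x y => (hf (g x) (g y)).trans (hg x y)
  inv_mem' := fun {f} hf x y => by
    have h := hf (f⁻¹ x) (f⁻¹ y)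
    rw [← LinearEquiv.mul_apply, ← LinearEquiv.mul_apply, mul_inv_cancel] at h
    exact h.symm

/-! ### Fractional ideals of the `p`-adic integers -/

/-- The fractional ideal `p ^ k ℤ_p` of `ℚ_p`, for an integer `k`. -/
def fracIdeal (p : ℕ) [Fact p.Prime] (k : ℤ) : Submodule ℤ_[p] ℚ_[p] :=
  Submodule.span ℤ_[p] {(p : ℚ_[p]) ^ k}

section

variable {p : ℕ} [Fact p.Prime]

theorem p_ne_zero : (p : ℚ_[p]) ≠ 0 :=
  Nat.cast_ne_zero.mpr (Fact.out : p.Prime).ne_zero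

theorem mem_fracIdeal {k : ℤ} {x : ℚ_[p]} :
    x ∈ fracIdeal p k ↔ ∃ c : ℤ_[p], (c : ℚ_[p]) * (p : ℚ_[p]) ^ k = x :=
  Submodule.mem_span_singleton

theorem zpow_mul_mem {k : ℤ} {x : ℚ_[p]} (m l : ℤ) (h : m + k = l) :
    (p : ℚ_[p]) ^ m * x ∈ fracIdeal p l ↔ x ∈ fracIdeal p k := by
  subst h
  simp only [mem_fracIdeal, zpow_add₀ (p_ne_zero (p := p))]
  have h0 : (p : ℚ_[p]) ^ m ≠ 0 := zpow_ne_zero _ p_ne_zero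
  constructor
  · rintro ⟨c, hc⟩
    exact ⟨c, mul_left_cancel₀ h0 (by rw [← hc]; ring)⟩
  · rintro ⟨c, hc⟩
    exact ⟨c, by rw [← hc]; ring⟩

theorem fracIdeal_anti {k l : ℤ} (h : k ≤ l) : fracIdeal p l ≤ fracIdeal p k := by
  intro x hx
  obtain ⟨c, rfl⟩ := mem_fracIdeal.1 hx
  obtain ⟨n, rfl⟩ := Int.le.dest h
  refine mem_fracIdeal.2 ⟨c * (p : ℤ_[p]) ^ n, ?_⟩
  rw [zpow_add₀ p_ne_zero]
  push_cast
  rw [zpow_natCast]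
  ring

/-- If `2x ∈ p ^ (k + 1) ℤ_p`, then `x ∈ p ^ k ℤ_p`. -/
theorem mem_of_two_mul_mem {k l : ℤ} (h : k + 1 ≤ l) {x : ℚ_[p]}
    (hx : 2 * x ∈ fracIdeal p l) : x ∈ fracIdeal p k := by
  have hx := fracIdeal_anti h hx
  by_cases hp : p = 2
  · have h2 : (2 : ℚ_[p]) = (p : ℚ_[p]) ^ (1 : ℤ) := by subst hp; simp
    rw [h2] at hx
    exact (zpow_mul_mem 1 _ (by ring)).1 hx
  · have hu : IsUnit (2 : ℤ_[p]) := by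
      have : IsUnit ((2 : ℕ) : ℤ_[p]) :=
        PadicInt.isUnit_iff.2 (by
          rw [PadicInt.norm_natCast_eq_one_iff]
          exact (Nat.coprime_primes Fact.out Nat.prime_two).2 hp)
      exact_mod_cast this
    obtain ⟨v, hv⟩ := hu.exists_left_inv
    have h1 := (fracIdeal p (k + 1)).smul_mem v hx
    have h2 : v • (2 * x) = x := by
      have h3 : (v * 2 : ℤ_[p]) • x = x := by rw [hv, one_smul]
      rw [mul_smul] at h3
      rw [two_mul, ← two_smul ℤ_[p] x]
      exact h3
    rw [h2] at h1
    exact fracIdeal_anti (by lia) h1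

end

/-! ### Lattices, dual lattices, Jordan decompositions

A `ℤ_p`-lattice is a finitely generated free `ℤ_p`-module `L` with a quadratic form
`q : L → ℚ_p`.  Its bilinear form `b(x, y) = q(x + y) - q(x) - q(y)` is
`QuadraticMap.polar q`. -/

variable {p : ℕ} [Fact p.Prime] {L : Type*} [AddCommGroup L] [Module ℤ_[p] L]

/-- The bilinear form of `q` is non-degenerate. -/
def IsNondegenerate (q : QuadraticMap ℤ_[p] L ℚ_[p]) : Prop :=
  ∀ x : L, (∀ y : L, QuadraticMap.polar q x y = 0) → x = 0

/-- The lattice `(L, q)` is even: `b(x, x) ∈ 2 ℤ_p` for all `x`. -/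
def IsEven (q : QuadraticMap ℤ_[p] L ℚ_[p]) : Prop :=
  ∀ x : L, ∃ c : ℤ_[p], QuadraticMap.polar q x x = 2 * (c : ℚ_[p])

/-- The lattice `(L, q)` is unimodular: in some basis its Gram matrix has entries in `ℤ_p`
and its determinant is a unit. -/
def IsUnimodular (q : QuadraticMap ℤ_[p] L ℚ_[p]) : Prop :=
  ∃ (n : ℕ) (v : Basis (Fin n) ℤ_[p] L) (G : Matrix (Fin n) (Fin n) ℤ_[p]),
    (∀ i j, QuadraticMap.polar q (v i) (v j) = (G i j : ℚ_[p])) ∧ IsUnit G.det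

/-- For a submodule `E` of `L`, the form `q_i = p ^ (-i) q` on `E`, so that the restriction
of `q` to `E` is `p ^ i q_i`. -/
def rescale (q : QuadraticMap ℤ_[p] L ℚ_[p]) (E : Submodule ℤ_[p] L) (i : ℤ) :
    QuadraticMap ℤ_[p] E ℚ_[p] :=
  (p : ℚ_[p]) ^ (-i) • q.restrict E

/-- A Jordan decomposition `(L, q) = ⨁ (L_i, p ^ i q_i)`, `i ∈ ℤ`: an orthogonal
decomposition with all `(L_i, q_i)` unimodular. -/
structure JordanDecomposition (q : QuadraticMap ℤ_[p] L ℚ_[p]) where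
  component : ℤ → Submodule ℤ_[p] L
  isInternal : DirectSum.IsInternal component
  orthogonal : ∀ i j, i ≠ j → ∀ x ∈ component i, ∀ y ∈ component j,
    QuadraticMap.polar q x y = 0
  unimodular : ∀ i, IsUnimodular (rescale q (component i) i)

/-- The unimodular lattice `(L_i, q_i)` of a Jordan decomposition. -/
def JordanDecomposition.form {q : QuadraticMap ℤ_[p] L ℚ_[p]} (J : JordanDecomposition q)
    (i : ℤ) : QuadraticMap ℤ_[p] (J.component i) ℚ_[p] :=
  rescale q (J.component i) i

/-- The `i`-th Jordan constituent of `(L, q)` is free: `(L_{i-1}, q_{i-1})` and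
`(L_{i+1}, q_{i+1})` are even.  This is the same for all Jordan decompositions, see
`isFree_iff`.  If it is not free, the constituent is bound. -/
def IsFree (q : QuadraticMap ℤ_[p] L ℚ_[p]) (i : ℤ) : Prop :=
  ∃ J : JordanDecomposition q, IsEven (J.form (i - 1)) ∧ IsEven (J.form (i + 1))

/-- For `y ∈ L`, the `ℚ_p`-linear extension of `b(y, ·)` to `ℚ_p ⊗ L`. -/
def polarExt (q : QuadraticMap ℤ_[p] L ℚ_[p]) (y : L) :
    ℚ_[p] ⊗[ℤ_[p]] L →ₗ[ℚ_[p]] ℚ_[p] :=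
  (QuadraticMap.polarBilin q y).liftBaseChange ℚ_[p]

/-- The dual lattice `L^∨ = {x ∈ ℚ_p ⊗ L | b(x, L) ⊆ ℤ_p}`. -/
def dualLattice (q : QuadraticMap ℤ_[p] L ℚ_[p]) : Submodule ℤ_[p] (ℚ_[p] ⊗[ℤ_[p]] L) where
  carrier := {x | ∀ y : L, ∃ c : ℤ_[p], polarExt q y x = (c : ℚ_[p])}
  zero_mem' := fun y => ⟨0, by simp⟩
  add_mem' := fun {x x'} hx hx' y => by
    obtain ⟨c, hc⟩ := hx y
    obtain ⟨c', hc'⟩ := hx' y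
    exact ⟨c + c', by rw [map_add, hc, hc']; push_cast; rfl⟩
  smul_mem' := fun a x hx y => by
    obtain ⟨c, hc⟩ := hx y
    refine ⟨a * c, ?_⟩
    have : a • x = (a : ℚ_[p]) • x := (algebraMap_smul ℚ_[p] a x).symm
    rw [this, map_smul, hc]
    push_cast
    rfl

/-- The submodule `p ^ i L^∨ ∩ L` of `L`. -/
def scaledDual (q : QuadraticMap ℤ_[p] L ℚ_[p]) (i : ℤ) : Submodule ℤ_[p] L :=
  ((p : ℚ_[p]) ^ i • dualLattice q).comap (TensorProduct.mk ℤ_[p] ℚ_[p] L 1)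

theorem mem_scaledDual {q : QuadraticMap ℤ_[p] L ℚ_[p]} {i : ℤ} {x : L} :
    x ∈ scaledDual q i ↔ ∀ y, QuadraticMap.polar q x y ∈ fracIdeal p i := by
  have h0 : (p : ℚ_[p]) ^ i ≠ 0 := zpow_ne_zero _ p_ne_zero
  have key : ∀ y, polarExt q y (TensorProduct.mk ℤ_[p] ℚ_[p] L 1 x)
      = QuadraticMap.polar q x y := by
    intro y
    rw [QuadraticMap.polar_comm]
    simp [polarExt, LinearMap.liftBaseChange_tmul]
  simp only [scaledDual, Submodule.mem_comap]
  constructor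
  · intro h y
    obtain ⟨z, hz, hzx⟩ := Submodule.mem_smul_pointwise_iff_exists _ _ _ |>.1 h
    obtain ⟨c, hc⟩ := hz y
    refine mem_fracIdeal.2 ⟨c, ?_⟩
    rw [← key, ← hzx, map_smul, hc, smul_eq_mul, mul_comm]
  · intro h
    refine Submodule.mem_smul_pointwise_iff_exists _ _ _ |>.2
      ⟨((p : ℚ_[p]) ^ i)⁻¹ • TensorProduct.mk ℤ_[p] ℚ_[p] L 1 x, ?_, smul_inv_smul₀ h0 _⟩
    intro y
    obtain ⟨c, hc⟩ := mem_fracIdeal.1 (h y)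
    refine ⟨c, ?_⟩
    rw [map_smul, key, ← hc, smul_eq_mul]
    field_simp

/-- The filtration `H_i = (p ^ i L^∨ ∩ L) + p L`, for `i ∈ ℤ`. -/
def filt (q : QuadraticMap ℤ_[p] L ℚ_[p]) (i : ℤ) : Submodule ℤ_[p] L :=
  scaledDual q i ⊔ (p : ℤ_[p]) • (⊤ : Submodule ℤ_[p] L)

/-- The graded piece `ρ_i(L) = H_i / H_{i+1}`. -/
abbrev rho (q : QuadraticMap ℤ_[p] L ℚ_[p]) (i : ℤ) : Type _ :=
  filt q i ⧸ (filt q (i + 1)).submoduleOf (filt q i)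

theorem mem_filt {q : QuadraticMap ℤ_[p] L ℚ_[p]} {i : ℤ} {x : L} :
    x ∈ filt q i ↔ ∃ u ∈ scaledDual q i, ∃ w : L, u + (p : ℤ_[p]) • w = x := by
  simp [filt, Submodule.mem_sup, Submodule.mem_smul_pointwise_iff_exists]

/-- The class in `ρ_i(L)` of an element of `p ^ i L^∨ ∩ L`. -/
def toRho (q : QuadraticMap ℤ_[p] L ℚ_[p]) (i : ℤ) : scaledDual q i →ₗ[ℤ_[p]] rho q i :=
  ((filt q (i + 1)).submoduleOf (filt q i)).mkQ ∘ₗ Submodule.inclusion le_sup_left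

theorem toRho_surjective (q : QuadraticMap ℤ_[p] L ℚ_[p]) (i : ℤ) :
    Function.Surjective (toRho q i) := by
  intro x
  obtain ⟨⟨x, hx⟩, rfl⟩ := Submodule.Quotient.mk_surjective _ x
  obtain ⟨u, hu, w, rfl⟩ := mem_filt.1 hx
  refine ⟨⟨u, hu⟩, (Submodule.Quotient.eq _).2 ?_⟩
  change u - (u + (p : ℤ_[p]) • w) ∈ filt q (i + 1)
  exact mem_filt.2 ⟨0, zero_mem _, -w, by simp⟩

theorem toRho_eq_iff {q : QuadraticMap ℤ_[p] L ℚ_[p]} {i : ℤ} {x y : scaledDual q i} :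
    toRho q i x = toRho q i y ↔ (x - y : L) ∈ filt q (i + 1) :=
  Submodule.Quotient.eq _

theorem scaledDual_anti (q : QuadraticMap ℤ_[p] L ℚ_[p]) {i j : ℤ} (h : i ≤ j) :
    scaledDual q j ≤ scaledDual q i := fun _ hx =>
  mem_scaledDual.2 fun y => fracIdeal_anti h (mem_scaledDual.1 hx y)

theorem p_smul_mem {k l : ℤ} (h : k + 1 = l) {x : ℚ_[p]} :
    (p : ℤ_[p]) • x ∈ fracIdeal p l ↔ x ∈ fracIdeal p k := by
  have h1 : (p : ℤ_[p]) • x = (p : ℚ_[p]) ^ (1 : ℤ) * x := by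
    rw [zpow_one]
    change ((p : ℤ_[p]) : ℚ_[p]) * x = _
    simp
  rw [h1]
  exact zpow_mul_mem 1 l (by lia)

/-- The values `p ^ (-i) b(x, y) mod p` only depend on the classes of `x`, `y` in `ρ_i(L)`. -/
theorem polar_mem_of_mem_filt {q : QuadraticMap ℤ_[p] L ℚ_[p]} {i : ℤ} {x y : L}
    (hx : x ∈ filt q (i + 1)) (hy : y ∈ scaledDual q i) :
    QuadraticMap.polar q x y ∈ fracIdeal p (i + 1) := by
  obtain ⟨u, hu, w, rfl⟩ := mem_filt.1 hx
  rw [QuadraticMap.polar_add_left, QuadraticMap.polar_smul_left]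
  refine add_mem (mem_scaledDual.1 hu y) ((p_smul_mem rfl).2 ?_)
  rw [QuadraticMap.polar_comm]
  exact mem_scaledDual.1 hy w

/-! ### Evenness of Jordan constituents -/

theorem polar_rescale (q : QuadraticMap ℤ_[p] L ℚ_[p]) (E : Submodule ℤ_[p] L) (i : ℤ)
    (x y : E) : QuadraticMap.polar (rescale q E i) x y
      = (p : ℚ_[p]) ^ (-i) * QuadraticMap.polar q (x : L) (y : L) := by
  simp only [QuadraticMap.polar, rescale, _root_.smul_apply, QuadraticMap.restrict_apply,
    Submodule.coe_add, smul_eq_mul]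
  ring

theorem polar_self_eq (q : QuadraticMap ℤ_[p] L ℚ_[p]) (x : L) :
    QuadraticMap.polar q x x = 2 * q x := by
  rw [QuadraticMap.polar_self, nsmul_eq_mul]; simp

theorem isEven_rescale_iff {q : QuadraticMap ℤ_[p] L ℚ_[p]} {E : Submodule ℤ_[p] L} {i : ℤ} :
    IsEven (rescale q E i) ↔ ∀ x ∈ E, q x ∈ fracIdeal p i := by
  have h0 : (p : ℚ_[p]) ^ i ≠ 0 := zpow_ne_zero _ p_ne_zero
  constructor
  · intro h x hx
    obtain ⟨c, hc⟩ := h ⟨x, hx⟩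
    rw [polar_rescale, polar_self_eq, zpow_neg] at hc
    refine mem_fracIdeal.2 ⟨c, ?_⟩
    field_simp at hc
    rw [hc]; ring
  · rintro h ⟨x, hx⟩
    obtain ⟨c, hc⟩ := mem_fracIdeal.1 (h x hx)
    refine ⟨c, ?_⟩
    rw [polar_rescale, polar_self_eq, zpow_neg, ← hc]
    field_simp

theorem IsUnimodular.polar_integral {q : QuadraticMap ℤ_[p] L ℚ_[p]} (h : IsUnimodular q)
    (x y : L) : QuadraticMap.polar q x y ∈ fracIdeal p 0 := by
  obtain ⟨n, v, G, hG, -⟩ := h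
  rw [← QuadraticMap.polarBilin_apply_apply, ← v.sum_repr x, ← v.sum_repr y]
  simp only [map_sum, LinearMap.sum_apply, map_smul, LinearMap.smul_apply]
  refine sum_mem fun j _ => Submodule.smul_mem _ _ (sum_mem fun i _ => Submodule.smul_mem _ _ ?_)
  rw [QuadraticMap.polarBilin_apply_apply, hG]
  exact mem_fracIdeal.2 ⟨G i j, by simp⟩

theorem IsUnimodular.exists_smul {q : QuadraticMap ℤ_[p] L ℚ_[p]} (h : IsUnimodular q)
    (n : ℕ) {x : L} (hx : ∀ y, QuadraticMap.polar q x y ∈ fracIdeal p n) :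
    ∃ z : L, x = (p : ℤ_[p]) ^ n • z := by
  obtain ⟨m, v, G, hG, hdet⟩ := h
  set c : Fin m → ℤ_[p] := fun j => v.repr x j with hc
  have h1 : ∀ i, ∃ d : ℤ_[p], (Matrix.vecMul c G) i = (p : ℤ_[p]) ^ n * d := by
    intro i
    obtain ⟨d, hd⟩ := mem_fracIdeal.1 (hx (v i))
    refine ⟨d, Subtype.coe_injective ?_⟩
    have h2 : QuadraticMap.polar q x (v i) = ((Matrix.vecMul c G i : ℤ_[p]) : ℚ_[p]) := by
      rw [← QuadraticMap.polarBilin_apply_apply]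
      conv_lhs => rw [← v.sum_repr x]
      simp only [map_sum, LinearMap.sum_apply, map_smul, LinearMap.smul_apply,
        QuadraticMap.polarBilin_apply_apply, hG, Matrix.vecMul, dotProduct]
      rw [PadicInt.coe_sum]
      rfl
    change ((Matrix.vecMul c G i : ℤ_[p]) : ℚ_[p]) = (((p : ℤ_[p]) ^ n * d : ℤ_[p]) : ℚ_[p])
    rw [← h2, ← hd]
    push_cast
    rw [zpow_natCast, mul_comm]
  choose d hd using h1
  have h3 : Matrix.vecMul c G = (p : ℤ_[p]) ^ n • d := funext hd
  have h4 : c = (p : ℤ_[p]) ^ n • Matrix.vecMul d G⁻¹ := by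
    rw [← Matrix.smul_vecMul, ← h3, Matrix.vecMul_vecMul, Matrix.mul_nonsing_inv _ hdet,
      Matrix.vecMul_one]
  refine ⟨∑ i, Matrix.vecMul d G⁻¹ i • v i, ?_⟩
  rw [Finset.smul_sum]
  conv_lhs => rw [← v.sum_repr x]
  refine Finset.sum_congr rfl fun i _ => ?_
  rw [smul_smul]
  congr 1
  exact congrFun h4 i

theorem polar_sum_right (q : QuadraticMap ℤ_[p] L ℚ_[p]) {ι : Type*} (s : Finset ι) (f : ι → L)
    (x : L) : QuadraticMap.polar q x (∑ i ∈ s, f i) = ∑ i ∈ s, QuadraticMap.polar q x (f i) := by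
  simp only [← QuadraticMap.polarBilin_apply_apply, map_sum]

theorem map_sum_of_orthogonal (q : QuadraticMap ℤ_[p] L ℚ_[p]) {ι : Type*} (s : Finset ι)
    (f : ι → L) (h : ∀ i j, i ≠ j → QuadraticMap.polar q (f i) (f j) = 0) :
    q (∑ i ∈ s, f i) = ∑ i ∈ s, q (f i) := by
  classical
  induction s using Finset.induction_on with
  | empty => simp
  | insert a s ha ih =>
    rw [Finset.sum_insert ha, Finset.sum_insert ha, QuadraticMap.map_add q, polar_sum_right, ih,
      Finset.sum_eq_zero (fun i hi => h a i (fun e => ha (e ▸ hi))), add_zero]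

/-- Evenness of a Jordan constituent, without reference to the Jordan decomposition. -/
theorem JordanDecomposition.isEven_iff {q : QuadraticMap ℤ_[p] L ℚ_[p]}
    (J : JordanDecomposition q) (k : ℤ) :
    IsEven (J.form k) ↔ ∀ x ∈ scaledDual q k, q x ∈ fracIdeal p k := by
  classical
  have hsum : ∀ x : L, ∃ (s : Finset ℤ) (f : ℤ → L), (∀ i, f i ∈ J.component i) ∧
      ∑ i ∈ s, f i = x := by
    intro x
    obtain ⟨d, hd⟩ := J.isInternal.surjective x
    refine ⟨d.support, fun i => (d i : L), fun i => (d i).2, ?_⟩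
    rw [← hd]
    exact (DirectSum.coeLinearMap_eq_dfinsuppSum J.component d).symm
  have hpol : ∀ i, ∀ x ∈ J.component i, ∀ y ∈ J.component i,
      QuadraticMap.polar q x y ∈ fracIdeal p i := by
    intro i x hx y hy
    have h1 := (J.unimodular i).polar_integral ⟨x, hx⟩ ⟨y, hy⟩
    rw [polar_rescale] at h1
    exact (zpow_mul_mem (-i) 0 (by ring)).1 h1
  rw [JordanDecomposition.form, isEven_rescale_iff]
  constructor
  · intro hev x hx
    obtain ⟨s, f, hf, rfl⟩ := hsum x
    have horth : ∀ i j, i ≠ j → QuadraticMap.polar q (f i) (f j) = 0 := fun i j hij =>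
      J.orthogonal i j hij _ (hf i) _ (hf j)
    rw [map_sum_of_orthogonal q s f horth]
    refine sum_mem fun j hj => ?_
    rcases lt_trichotomy j k with hjk | rfl | hjk
    · obtain ⟨m, hm⟩ := Int.le.dest hjk.le
      have h2 : ∀ y : J.component j, QuadraticMap.polar (rescale q (J.component j) j)
          ⟨f j, hf j⟩ y ∈ fracIdeal p m := by
        intro y
        rw [polar_rescale]
        refine (zpow_mul_mem (-j) m (k := k) (by lia)).2 ?_
        have h3 := mem_scaledDual.1 hx (y : L)
        rw [QuadraticMap.polar_comm, polar_sum_right, Finset.sum_eq_single j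
          (fun i _ hij => J.orthogonal j i (Ne.symm hij) _ y.2 _ (hf i))
          (fun h => absurd hj h), QuadraticMap.polar_comm] at h3
        exact h3
      obtain ⟨z, hz⟩ := (J.unimodular j).exists_smul m h2
      have hz' : f j = (p : ℤ_[p]) ^ m • (z : L) := congrArg Subtype.val hz
      have h4 : q z ∈ fracIdeal p (j - 1) := by
        have h5 := hpol j z z.2 z z.2
        rw [polar_self_eq] at h5
        exact mem_of_two_mul_mem (by lia) h5
      have h6 : q (f j) = (p : ℚ_[p]) ^ (2 * m : ℤ) * q z := by
        rw [hz', QuadraticMap.map_smul]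
        change (((p : ℤ_[p]) ^ m * (p : ℤ_[p]) ^ m : ℤ_[p]) : ℚ_[p]) * _ = _
        push_cast
        rw [two_mul, zpow_add₀ p_ne_zero, zpow_natCast]
      rw [h6]
      exact fracIdeal_anti (by lia) ((zpow_mul_mem (2 * m : ℤ) _ rfl).2 h4)
    · exact hev _ (hf j)
    · have h5 := hpol j _ (hf j) _ (hf j)
      rw [polar_self_eq] at h5
      exact mem_of_two_mul_mem (by lia) h5
  · intro h x hx
    refine h x (mem_scaledDual.2 fun y => ?_)
    obtain ⟨s, f, hf, rfl⟩ := hsum y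
    rw [polar_sum_right]
    refine sum_mem fun j _ => ?_
    by_cases hjk : j = k
    · subst hjk
      exact hpol j x hx _ (hf j)
    · rw [J.orthogonal k j (Ne.symm hjk) x hx _ (hf j)]
      exact zero_mem _

/-- Freeness does not depend on the Jordan decomposition. -/
theorem isFree_iff {q : QuadraticMap ℤ_[p] L ℚ_[p]} (J : JordanDecomposition q) (i : ℤ) :
    IsFree q i ↔ IsEven (J.form (i - 1)) ∧ IsEven (J.form (i + 1)) := by
  constructor
  · rintro ⟨J', h1, h2⟩
    rw [J'.isEven_iff] at h1 h2
    rw [J.isEven_iff, J.isEven_iff]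
    exact ⟨h1, h2⟩
  · exact fun h => ⟨J, h⟩

/-- If the `i`-th constituent is free, the values `p ^ (-i) q(x) mod p` only depend on the
class of `x` in `ρ_i(L)`. -/
theorem IsFree.map_sub_map_mem {q : QuadraticMap ℤ_[p] L ℚ_[p]} {i : ℤ} (h : IsFree q i)
    {x y : scaledDual q i} (hxy : toRho q i x = toRho q i y) :
    q x - q y ∈ fracIdeal p (i + 1) := by
  obtain ⟨J, h1, h2⟩ := h
  rw [J.isEven_iff] at h1 h2
  obtain ⟨x, hx⟩ := x
  obtain ⟨y, hy⟩ := y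
  have hd := toRho_eq_iff.1 hxy
  change x - y ∈ _ at hd
  change q x - q y ∈ _
  have hdM : x - y ∈ scaledDual q i := sub_mem hx hy
  obtain ⟨u, hu, w, huw⟩ := mem_filt.1 hd
  have hw : w ∈ scaledDual q (i - 1) := by
    have h3 : (p : ℤ_[p]) • w ∈ scaledDual q i := by
      have : (p : ℤ_[p]) • w = (x - y) - u := by rw [← huw]; abel
      rw [this]
      exact sub_mem hdM (scaledDual_anti q (by lia) hu)
    refine mem_scaledDual.2 fun z => ?_
    have h4 := mem_scaledDual.1 h3 z
    rw [QuadraticMap.polar_smul_left] at h4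
    exact (p_smul_mem (by ring)).1 h4
  have hx' : x = y + (u + (p : ℤ_[p]) • w) := by rw [huw]; abel
  have e1 : q x - q y = q u + (p : ℤ_[p]) • (p : ℤ_[p]) • q w
      + (p : ℤ_[p]) • QuadraticMap.polar q u w + QuadraticMap.polar q (x - y) y := by
    rw [← huw, hx', QuadraticMap.map_add q, QuadraticMap.map_add q, QuadraticMap.map_smul,
      QuadraticMap.polar_smul_right, QuadraticMap.polar_comm q y, smul_smul]
    abel
  rw [e1]
  refine add_mem (add_mem (add_mem (h2 u hu) ?_) ?_) (polar_mem_of_mem_filt hd hy)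
  · exact (p_smul_mem rfl).2 ((p_smul_mem (by ring)).2 (h1 w hw))
  · exact Submodule.smul_mem _ _ (mem_scaledDual.1 hu w)

/-! ### The forms on the graded pieces -/

/-- The module `ℚ_p / p ℤ_p ≅ ℚ / p ℤ` in which the forms on `ρ_i(L)` take values. -/
abbrev RhoValue (p : ℕ) [Fact p.Prime] : Type := ℚ_[p] ⧸ fracIdeal p 1

/-- The class of `p ^ (-i) a` in `ℚ_p / p ℤ_p`. -/
def valueMk (i : ℤ) : ℚ_[p] →ₗ[ℤ_[p]] RhoValue p :=
  (fracIdeal p 1).mkQ ∘ₗ LinearMap.mulLeft ℤ_[p] ((p : ℚ_[p]) ^ (-i))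

theorem valueMk_eq {i : ℤ} {a b : ℚ_[p]} (h : a - b ∈ fracIdeal p (i + 1)) :
    valueMk i a = valueMk i b := by
  refine (Submodule.Quotient.eq _).2 ?_
  change (p : ℚ_[p]) ^ (-i) * a - (p : ℚ_[p]) ^ (-i) * b ∈ _
  rw [← mul_sub]
  exact (zpow_mul_mem (-i) 1 (by ring)).2 h

/-- A representative in `p ^ i L^∨ ∩ L` of a class in `ρ_i(L)`. -/
def rep (q : QuadraticMap ℤ_[p] L ℚ_[p]) (i : ℤ) : rho q i → scaledDual q i :=
  Function.surjInv (toRho_surjective q i)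

theorem toRho_rep (q : QuadraticMap ℤ_[p] L ℚ_[p]) (i : ℤ) (x : rho q i) :
    toRho q i (rep q i x) = x :=
  Function.surjInv_eq (toRho_surjective q i) x

theorem valueMk_polar_eq {q : QuadraticMap ℤ_[p] L ℚ_[p]} {i : ℤ} {x x' y y' : scaledDual q i}
    (hx : toRho q i x = toRho q i x') (hy : toRho q i y = toRho q i y') :
    valueMk i (QuadraticMap.polar q (x : L) (y : L))
      = valueMk i (QuadraticMap.polar q (x' : L) (y' : L)) := by
  refine valueMk_eq ?_
  have e : QuadraticMap.polar q (x : L) (y : L) - QuadraticMap.polar q (x' : L) (y' : L)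
      = QuadraticMap.polar q (x - x' : L) (y : L)
        + QuadraticMap.polar q (y - y' : L) (x' : L) := by
    rw [QuadraticMap.polar_sub_left, QuadraticMap.polar_sub_left,
      QuadraticMap.polar_comm q (y : L), QuadraticMap.polar_comm q (y' : L)]
    abel
  rw [e]
  exact add_mem (polar_mem_of_mem_filt (toRho_eq_iff.1 hx) y.2)
    (polar_mem_of_mem_filt (toRho_eq_iff.1 hy) x'.2)

/-- The bilinear form `b̄_i` on `ρ_i(L)`: for `x, y ∈ p ^ i L^∨ ∩ L`, the value at the classes
of `x` and `y` is `b_i(x, y) mod p`, where `b_i = p ^ (-i) b`; see `bbar_toRho`. -/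
def bbar (q : QuadraticMap ℤ_[p] L ℚ_[p]) (i : ℤ) :
    LinearMap.BilinMap ℤ_[p] (rho q i) (RhoValue p) :=
  LinearMap.mk₂ ℤ_[p]
    (fun x y => valueMk i (QuadraticMap.polar q (rep q i x : L) (rep q i y : L)))
    (fun x x' y => by
      rw [← map_add, ← QuadraticMap.polar_add_left, ← Submodule.coe_add]
      exact valueMk_polar_eq (by simp only [map_add, toRho_rep]) rfl)
    (fun c x y => by
      rw [← map_smul, ← QuadraticMap.polar_smul_left, ← Submodule.coe_smul]
      exact valueMk_polar_eq (by simp only [map_smul, toRho_rep]) rfl)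
    (fun x y y' => by
      rw [← map_add, ← QuadraticMap.polar_add_right, ← Submodule.coe_add]
      exact valueMk_polar_eq rfl (by simp only [map_add, toRho_rep]))
    (fun c x y => by
      rw [← map_smul, ← QuadraticMap.polar_smul_right, ← Submodule.coe_smul]
      exact valueMk_polar_eq rfl (by simp only [map_smul, toRho_rep]))

theorem bbar_toRho (q : QuadraticMap ℤ_[p] L ℚ_[p]) (i : ℤ) (x y : scaledDual q i) :
    bbar q i (toRho q i x) (toRho q i y)
      = valueMk i (QuadraticMap.polar q (x : L) (y : L)) :=
  valueMk_polar_eq (toRho_rep q i _) (toRho_rep q i _)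

theorem IsFree.valueMk_eq {q : QuadraticMap ℤ_[p] L ℚ_[p]} {i : ℤ} (h : IsFree q i)
    {x y : scaledDual q i} (hxy : toRho q i x = toRho q i y) :
    valueMk i (q x) = valueMk i (q y) :=
  PadicLattice.valueMk_eq (h.map_sub_map_mem hxy)

/-- The quadratic form `q̄_i` on `ρ_i(L)`, if the `i`-th constituent is free: for
`x ∈ p ^ i L^∨ ∩ L`, the value at the class of `x` is `q_i(x) mod p`, where
`q_i = p ^ (-i) q`; see `qbar_toRho`. -/
def qbar (q : QuadraticMap ℤ_[p] L ℚ_[p]) (i : ℤ) (h : IsFree q i) :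
    QuadraticMap ℤ_[p] (rho q i) (RhoValue p) where
  toFun x := valueMk i (q (rep q i x))
  toFun_smul c x := by
    rw [← map_smul, ← QuadraticMap.map_smul, ← Submodule.coe_smul]
    exact h.valueMk_eq (by simp only [map_smul, toRho_rep])
  exists_companion' := ⟨bbar q i, fun x y => by
    have e : bbar q i x y = valueMk i (QuadraticMap.polar q (rep q i x : L) (rep q i y : L)) :=
      rfl
    rw [e, ← map_add, ← map_add, ← QuadraticMap.map_add q, ← Submodule.coe_add]
    exact h.valueMk_eq (by simp only [map_add, toRho_rep])⟩

theorem qbar_toRho (q : QuadraticMap ℤ_[p] L ℚ_[p]) (i : ℤ) (h : IsFree q i)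
    (x : scaledDual q i) : qbar q i h (toRho q i x) = valueMk i (q x) :=
  h.valueMk_eq (toRho_rep q i _)

open Classical in
/-- The group `O(ρ_i(L))`: the orthogonal group of `q̄_i` if the `i`-th constituent is free,
and that of `b̄_i` if it is bound. -/
def rhoOrthogonalGroup (q : QuadraticMap ℤ_[p] L ℚ_[p]) (i : ℤ) :
    Subgroup (rho q i ≃ₗ[ℤ_[p]] rho q i) :=
  if h : IsFree q i then quadOrthogonalGroup (qbar q i h) else bilinOrthogonalGroup (bbar q i)

/-! ### The natural homomorphism -/

theorem polar_map {q : QuadraticMap ℤ_[p] L ℚ_[p]} {f : L ≃ₗ[ℤ_[p]] L}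
    (hf : f ∈ quadOrthogonalGroup q) (x y : L) :
    QuadraticMap.polar q (f x) (f y) = QuadraticMap.polar q x y := by
  have hf : ∀ x, q (f x) = q x := hf
  simp only [QuadraticMap.polar, ← map_add, hf]

theorem map_mem_scaledDual {q : QuadraticMap ℤ_[p] L ℚ_[p]} (f : quadOrthogonalGroup q)
    (i : ℤ) {x : L} (hx : x ∈ scaledDual q i) :
    (f : L ≃ₗ[ℤ_[p]] L) x ∈ scaledDual q i := by
  refine mem_scaledDual.2 fun y => ?_
  rw [← (f : L ≃ₗ[ℤ_[p]] L).apply_symm_apply y, polar_map f.2]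
  exact mem_scaledDual.1 hx _

theorem map_mem_filt {q : QuadraticMap ℤ_[p] L ℚ_[p]} (f : quadOrthogonalGroup q)
    (i : ℤ) {x : L} (hx : x ∈ filt q i) : (f : L ≃ₗ[ℤ_[p]] L) x ∈ filt q i := by
  obtain ⟨u, hu, w, rfl⟩ := mem_filt.1 hx
  exact mem_filt.2 ⟨_, map_mem_scaledDual f i hu, (f : L ≃ₗ[ℤ_[p]] L) w, by simp⟩

/-- The endomorphism of `ρ_i(L)` induced by an isometry `f`: the class of `x ∈ H_i` is mapped
to the class of `f x`. -/
def rhoMap (q : QuadraticMap ℤ_[p] L ℚ_[p]) (i : ℤ) (f : quadOrthogonalGroup q) :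
    rho q i →ₗ[ℤ_[p]] rho q i :=
  Submodule.mapQ _ _
    ((f : L ≃ₗ[ℤ_[p]] L).toLinearMap.restrict (fun _ hx => map_mem_filt f i hx))
    (fun _ hx => map_mem_filt f (i + 1) hx)

theorem rhoMap_toRho (q : QuadraticMap ℤ_[p] L ℚ_[p]) (i : ℤ) (f : quadOrthogonalGroup q)
    (x : scaledDual q i) : rhoMap q i f (toRho q i x)
      = toRho q i ⟨(f : L ≃ₗ[ℤ_[p]] L) x, map_mem_scaledDual f i x.2⟩ :=
  rfl

theorem rhoMap_mul (q : QuadraticMap ℤ_[p] L ℚ_[p]) (i : ℤ) (f g : quadOrthogonalGroup q)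
    (x : rho q i) : rhoMap q i (f * g) x = rhoMap q i f (rhoMap q i g x) := by
  obtain ⟨x, rfl⟩ := toRho_surjective q i x
  rfl

theorem rhoMap_one (q : QuadraticMap ℤ_[p] L ℚ_[p]) (i : ℤ) (x : rho q i) :
    rhoMap q i 1 x = x := by
  obtain ⟨x, rfl⟩ := toRho_surjective q i x
  rfl

/-- The automorphism of `ρ_i(L)` induced by an isometry of `L`. -/
def rhoEquiv (q : QuadraticMap ℤ_[p] L ℚ_[p]) (i : ℤ) (f : quadOrthogonalGroup q) :
    rho q i ≃ₗ[ℤ_[p]] rho q i :=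
  LinearEquiv.ofLinearMap (rhoMap q i f) (rhoMap q i f⁻¹)
    (LinearMap.ext fun x => by
      rw [LinearMap.comp_apply, ← rhoMap_mul, mul_inv_cancel, rhoMap_one]; rfl)
    (LinearMap.ext fun x => by
      rw [LinearMap.comp_apply, ← rhoMap_mul, inv_mul_cancel, rhoMap_one]; rfl)

theorem rhoEquiv_mem (q : QuadraticMap ℤ_[p] L ℚ_[p]) (i : ℤ) (f : quadOrthogonalGroup q) :
    rhoEquiv q i f ∈ rhoOrthogonalGroup q i := by
  unfold rhoOrthogonalGroup
  split_ifs with h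
  · intro x
    obtain ⟨x, rfl⟩ := toRho_surjective q i x
    change qbar q i h (rhoMap q i f _) = _
    rw [rhoMap_toRho, qbar_toRho, qbar_toRho]
    exact congrArg _ (f.2 x)
  · intro x y
    obtain ⟨x, rfl⟩ := toRho_surjective q i x
    obtain ⟨y, rfl⟩ := toRho_surjective q i y
    change bbar q i (rhoMap q i f _) (rhoMap q i f _) = _
    rw [rhoMap_toRho, rhoMap_toRho, bbar_toRho, bbar_toRho]
    exact congrArg _ (polar_map f.2 x y)

/-- The natural homomorphism `O(L, q) → ∏_i O(ρ_i(L))`. -/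
def naturalHom (q : QuadraticMap ℤ_[p] L ℚ_[p]) :
    quadOrthogonalGroup q →* ((i : ℤ) → rhoOrthogonalGroup q i) where
  toFun f i := ⟨rhoEquiv q i f, rhoEquiv_mem q i f⟩
  map_one' := funext fun i => Subtype.ext (LinearEquiv.ext fun x => rhoMap_one q i x)
  map_mul' f g := funext fun i => Subtype.ext (LinearEquiv.ext fun x => rhoMap_mul q i f g x)

end

end PadicLattice

/-! Fix a Jordan decomposition. Each ρ_i(L) is represented by vectors of L_i, and only finitely many
L_i are nonzero. So it suffices to realise a single σ ∈ O(ρ_i(L)) by an isometry of L acting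
trivially on every other ρ_l(L) (`JordanDecomposition.exists_rhoEquiv_eq`), and then to multiply
such isometries. Let S be the Gram matrix of p^(-i) b on L_i; σ is given by a matrix g with gᵀSg ≡ S
mod p.

Free case. Preserving q̄_i means that the form ½ xᵀ(S - gᵀSg)x is divisible by p. Then g lifts to an
exact isometry g' ≡ g mod p (`exists_lift_isometry`), which is extended by the identity on the
orthogonal complement of L_i. The lift comes from Newton's method. If p is odd it runs at once; if p
= 2 it runs from precision 4 on, and the step from 2 to 4 meets an obstruction: for u with Sgu =
diag S, the value uᵀ(S - gᵀSg)u must be divisible by 8. This holds because u and gu are both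
characteristic for S modulo 2, and values of characteristic vectors agree modulo 8
(`eight_dvd_of_characteristic`).

Bound case. A neighbour L_j, j = i ± 1, is odd, so p = 2 and some f ∈ L_j has b(f, f) = ε 2^j with ε
a unit. Now only S - gᵀSg is divisible by 2, and its halved form is, modulo 2, the square of a
linear form α. The same lifting gives g'ᵀSg' = S - 2ε ααᵀ, and the defect is absorbed by f: the map
d ↦ g'd + (α·d) s f, with s² 2^j = 2 · 2^i, is an isometric embedding of L_i into L_i ⊕ ℤ_2 f. By
the matrix determinant lemma the orthogonal complement of its image is spanned by a vector of the
same norm as f, so it extends to an isometry of L (`exists_isometry_of_frame_sup_line`). That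
isometry moves f only by elements of H_(j+1), so it is trivial on ρ_j(L) as well. -/

namespace PadicLattice

open Matrix

/-! ### Newton's method for gᵀSg = T over ℤ_p, with the delicate first step at p = 2. -/

section HenselMatrix

/-- The quadratic form `x ↦ xᵀ D x / 2` of a symmetric matrix `D` is divisible by `a`: all
entries of `D` are divisible by `a`, and the diagonal ones by `2 a`. -/
def FormDvd {R ι : Type*} [CommRing R] (a : R) (D : Matrix ι ι R) : Prop :=
  (∀ i j, a ∣ D i j) ∧ ∀ i, 2 * a ∣ D i i

/-- The strict upper triangle of D together with half its diagonal works. Such a Z is unique only up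
to an alternating matrix, a freedom exploited at p = 2. -/
theorem exists_add_transpose_eq {R : Type*} [CommRing R] {n : ℕ} {D : Matrix (Fin n) (Fin n) R}
    (hD : Dᵀ = D) (h2 : ∀ i, 2 ∣ D i i) : ∃ Z : Matrix (Fin n) (Fin n) R, Z + Zᵀ = D := by
  choose e he using h2
  refine ⟨Matrix.of fun i j => if i < j then D i j else if i = j then e i else 0, ?_⟩
  ext i j
  have hs : D j i = D i j := congrFun (congrFun hD i) j
  rw [Matrix.add_apply, Matrix.transpose_apply, of_apply, of_apply]
  rcases lt_trichotomy i j with h | rfl | h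
  · simp [h, h.not_gt, h.ne']
  · simp [he, two_mul]
  · simp [h, h.not_gt, h.ne', hs]

theorem FormDvd.exists_add_transpose {R : Type*} [CommRing R] [IsDomain R] {n : ℕ} {a : R}
    (ha : a ≠ 0) {D : Matrix (Fin n) (Fin n) R} (hD : Dᵀ = D) (h : FormDvd a D) :
    ∃ Z : Matrix (Fin n) (Fin n) R, a • (Z + Zᵀ) = D := by
  choose e he using h.1
  have hes : (Matrix.of e)ᵀ = Matrix.of e := by
    ext i j
    refine mul_left_cancel₀ ha ?_
    have hs : D j i = D i j := congrFun (congrFun hD i) j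
    simp only [transpose_apply, of_apply]
    rw [← he, ← he, hs]
  obtain ⟨Z, hZ⟩ := exists_add_transpose_eq hes (fun i => by
    obtain ⟨c, hc⟩ := h.2 i
    refine ⟨c, mul_left_cancel₀ ha ?_⟩
    rw [of_apply, ← he, hc]
    ring)
  refine ⟨Z, ?_⟩
  rw [hZ]
  ext i j
  exact (he i j).symm

/-- One step of Newton's method for the equation `gᵀ S g = T`. -/
theorem sub_transpose_mul_mul_add_smul {R ι : Type*} [CommRing R] [Fintype ι] [DecidableEq ι]
    {S T g Z : Matrix ι ι R} {a : R} (hS : Sᵀ = S) (hSu : IsUnit S.det) (hgu : IsUnit g.det)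
    (hZ : a • (Z + Zᵀ) = T - gᵀ * S * g) :
    T - (g + a • ((gᵀ * S)⁻¹ * Z))ᵀ * S * (g + a • ((gᵀ * S)⁻¹ * Z))
      = -(a ^ 2 • (((gᵀ * S)⁻¹ * Z)ᵀ * S * ((gᵀ * S)⁻¹ * Z))) := by
  have hu : IsUnit (gᵀ * S).det := by
    rw [det_mul, det_transpose]
    exact hgu.mul hSu
  -- The linearised equation is gᵀSh + hᵀSg = Z + Zᵀ; solving gᵀSh = Z settles both summands at
  -- once, since S is symmetric. Only the quadratic term survives.
  set h := (gᵀ * S)⁻¹ * Z with hh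
  have h1 : gᵀ * S * h = Z := by
    rw [hh, ← Matrix.mul_assoc, mul_nonsing_inv _ hu, Matrix.one_mul]
  clear_value h
  have h2 : hᵀ * S * g = Zᵀ := by
    rw [← h1, transpose_mul, transpose_mul, transpose_transpose, hS, Matrix.mul_assoc]
  have h3 : T = a • (Z + Zᵀ) + gᵀ * S * g := by rw [hZ]; abel
  rw [transpose_add, transpose_smul, Matrix.add_mul, Matrix.add_mul, Matrix.mul_add,
    Matrix.mul_add, Matrix.mul_smul, h1, Matrix.smul_mul, Matrix.smul_mul, h2, Matrix.smul_mul,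
    Matrix.mul_smul, smul_smul, h3, pow_two, smul_add]
  abel

theorem isSymm_sub_conj {R ι : Type*} [CommRing R] [Fintype ι] {S T : Matrix ι ι R}
    (hS : Sᵀ = S) (hT : Tᵀ = T) (g : Matrix ι ι R) :
    (T - gᵀ * S * g)ᵀ = T - gᵀ * S * g := by
  simp only [transpose_sub, transpose_mul, transpose_transpose, hS, hT, Matrix.mul_assoc]

theorem two_dvd_sq_sub_self (x : ℤ_[2]) : 2 ∣ x * x - x := by
  have h : x * x - x = x * (x - 1) := by ring
  have h2 : (2 : ℤ_[2]) = ((2 : ℕ) : ℤ_[2]) := by norm_num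
  obtain ⟨n, hn, hx⟩ := PadicInt.exists_mem_range x
  rw [PadicInt.maximalIdeal_eq_span_p, Ideal.mem_span_singleton, ← h2] at hx
  rw [h]
  interval_cases n
  · exact Dvd.dvd.mul_right (by simpa using hx) _
  · exact Dvd.dvd.mul_left (by simpa using hx) _

theorem isUnit_of_not_two_dvd {x : ℤ_[2]} (h : ¬ 2 ∣ x) : IsUnit x := by
  have h2 : (2 : ℤ_[2]) = ((2 : ℕ) : ℤ_[2]) := by norm_num
  by_contra hx
  rw [← mem_nonunits_iff, ← IsLocalRing.mem_maximalIdeal, PadicInt.maximalIdeal_eq_span_p,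
    Ideal.mem_span_singleton, ← h2] at hx
  exact h hx

/-- The diagonal of a symmetric matrix represents the form `x ↦ xᵀ S x` modulo `2`. -/
theorem two_dvd_dotProduct_mulVec_sub {n : ℕ} {S : Matrix (Fin n) (Fin n) ℤ_[2]} (hS : Sᵀ = S)
    (x : Fin n → ℤ_[2]) : 2 ∣ x ⬝ᵥ S *ᵥ x - S.diag ⬝ᵥ x := by
  -- The off-diagonal part of S contributes an even number, and on the diagonal x² ≡ x because the
  -- residue field is 𝔽_2.
  obtain ⟨Z, hZ⟩ := exists_add_transpose_eq (D := S - diagonal S.diag)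
    (by rw [transpose_sub, hS, diagonal_transpose]) (fun i => by simp)
  have h1 : x ⬝ᵥ S *ᵥ x = 2 * (x ⬝ᵥ Z *ᵥ x) + x ⬝ᵥ diagonal S.diag *ᵥ x := by
    have h2 : S = Z + Zᵀ + diagonal S.diag := by rw [hZ]; abel
    have h3 : x ⬝ᵥ Zᵀ *ᵥ x = x ⬝ᵥ Z *ᵥ x := by
      rw [mulVec_transpose, dotProduct_comm, dotProduct_mulVec]
    conv_lhs => rw [h2]
    rw [add_mulVec, add_mulVec, dotProduct_add, dotProduct_add, h3]
    ring
  have h4 : x ⬝ᵥ diagonal S.diag *ᵥ x - S.diag ⬝ᵥ x = ∑ i, S i i * (x i * x i - x i) := by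
    simp only [dotProduct, mulVec_diagonal, diag_apply, ← Finset.sum_sub_distrib]
    exact Finset.sum_congr rfl fun i _ => by ring
  rw [h1, add_sub_assoc, h4]
  exact dvd_add (dvd_mul_right _ _)
    (Finset.dvd_sum fun i _ => Dvd.dvd.mul_left (two_dvd_sq_sub_self _) _)

/-- Changing Z by an alternating matrix does not change uᵀZu, so its evenness is necessary for uᵀZ'
≡ 0 mod 2. It is also sufficient, which removes the obstruction in the first Newton step at p = 2.
-/
theorem exists_add_transpose_eq_of_two_dvd {n : ℕ} {Z : Matrix (Fin n) (Fin n) ℤ_[2]}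
    {u : Fin n → ℤ_[2]} (hu : 2 ∣ u ⬝ᵥ Z *ᵥ u) :
    ∃ Z' : Matrix (Fin n) (Fin n) ℤ_[2], Z' + Z'ᵀ = Z + Zᵀ ∧ ∀ i, 2 ∣ (u ᵥ* Z') i := by
  by_cases h : ∀ i, 2 ∣ u i
  · refine ⟨Z, rfl, fun i => ?_⟩
    rw [vecMul, dotProduct]
    exact Finset.dvd_sum fun j _ => Dvd.dvd.mul_right (h j) _
  · push Not at h
    obtain ⟨m, hm⟩ := h
    obtain ⟨c, hc⟩ := (isUnit_of_not_two_dvd hm).exists_right_inv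
    set l := u ᵥ* Z with hl
    set w : Fin n → ℤ_[2] := Pi.single m c with hw
    have huw : u ⬝ᵥ w = 1 := by rw [hw, dotProduct_single, hc]
    -- With l = uᵀZ and u·w = 1, the correction cancels l and leaves uᵀZ' = (uᵀZu) w.
    refine ⟨Z - vecMulVec w l + vecMulVec l w, ?_, fun i => ?_⟩
    · rw [transpose_add, transpose_sub, transpose_vecMulVec, transpose_vecMulVec]
      abel
    · rw [vecMul_add, vecMul_sub, vecMul_vecMulVec, vecMul_vecMulVec, huw, ← hl]
      have : u ⬝ᵥ l = u ⬝ᵥ Z *ᵥ u := by rw [hl, dotProduct_mulVec, dotProduct_comm]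
      rw [this]
      simp only [one_smul, sub_self, zero_add, Pi.smul_apply, smul_eq_mul]
      exact Dvd.dvd.mul_right hu _

/-- The first step in lifting a solution of `gᵀ S g = T` modulo `2` to `ℤ_2`. -/
theorem exists_formDvd_four {n : ℕ} {S T g : Matrix (Fin n) (Fin n) ℤ_[2]} (hS : Sᵀ = S)
    (hT : Tᵀ = T) (hSu : IsUnit S.det) (hgu : IsUnit g.det) (h : FormDvd 2 (T - gᵀ * S * g))
    {u : Fin n → ℤ_[2]} (hu : (S * g) *ᵥ u = S.diag)
    (h8 : 8 ∣ u ⬝ᵥ (T - gᵀ * S * g) *ᵥ u) :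
    ∃ k : Matrix (Fin n) (Fin n) ℤ_[2],
      FormDvd 4 (T - (g + (2 : ℤ_[2]) • k)ᵀ * S * (g + (2 : ℤ_[2]) • k)) := by
  obtain ⟨Z₀, hZ₀⟩ := h.exists_add_transpose two_ne_zero (isSymm_sub_conj hS hT g)
  -- The error matrix is 2(Z₀ + Z₀ᵀ), so its value at u is 4 uᵀZ₀u.
  have hu0 : 2 ∣ u ⬝ᵥ Z₀ *ᵥ u := by
    rw [← hZ₀, smul_mulVec, dotProduct_smul, add_mulVec, dotProduct_add, mulVec_transpose,
      dotProduct_comm u (u ᵥ* Z₀), ← dotProduct_mulVec, ← two_mul, smul_eq_mul, ← mul_assoc] at h8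
    have h9 : (8 : ℤ_[2]) = 2 * 2 * 2 := by norm_num
    rw [h9] at h8
    exact (mul_dvd_mul_iff_left (by norm_num)).1 h8
  obtain ⟨Z, hZ, hZu⟩ := exists_add_transpose_eq_of_two_dvd hu0
  rw [← hZ] at hZ₀
  refine ⟨(gᵀ * S)⁻¹ * Z, ?_⟩
  rw [sub_transpose_mul_mul_add_smul hS hSu hgu hZ₀]
  have huu : IsUnit (gᵀ * S).det := by
    rw [det_mul, det_transpose]
    exact hgu.mul hSu
  have hd : S.diag ᵥ* (gᵀ * S)⁻¹ = u := by
    have : S * g = (gᵀ * S)ᵀ := by rw [transpose_mul, transpose_transpose, hS]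
    rw [← hu, this, mulVec_transpose, vecMul_vecMul, mul_nonsing_inv _ huu, vecMul_one]
  set k := (gᵀ * S)⁻¹ * Z with hk
  -- The new error is -4 kᵀSk, whose diagonal must be divisible by 8. Modulo 2 the diagonal of kᵀSk
  -- is (diag S)ᵀk = uᵀZ, which is even by the choice of Z.
  have hdk : S.diag ᵥ* k = u ᵥ* Z := by rw [hk, ← vecMul_vecMul, hd]
  have e4 : ((2 : ℤ_[2]) ^ 2) = 4 := by norm_num
  rw [e4]
  refine ⟨fun i j => ?_, fun i => ?_⟩
  · simp only [Matrix.neg_apply, Matrix.smul_apply, smul_eq_mul, dvd_neg]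
    exact dvd_mul_right _ _
  · simp only [Matrix.neg_apply, Matrix.smul_apply, smul_eq_mul, dvd_neg]
    rw [mul_comm 2]
    refine mul_dvd_mul_left _ ?_
    have h5 : (kᵀ * S * k) i i = (fun j => k j i) ⬝ᵥ S *ᵥ (fun j => k j i) := by
      rw [Matrix.mul_assoc]
      rfl
    have h6 := two_dvd_dotProduct_mulVec_sub hS (fun j => k j i)
    have h7 : S.diag ⬝ᵥ (fun j => k j i) = (S.diag ᵥ* k) i := rfl
    rw [h5]
    rw [h7, hdk] at h6
    exact (dvd_iff_dvd_of_dvd_sub h6).2 (hZu i)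

variable {p : ℕ} [Fact p.Prime]

theorem isUnit_of_p_dvd_sub {x y : ℤ_[p]} (h : (p : ℤ_[p]) ∣ x - y) (hy : IsUnit y) :
    IsUnit x := by
  by_contra hx
  rw [← mem_nonunits_iff, ← IsLocalRing.mem_maximalIdeal, PadicInt.maximalIdeal_eq_span_p,
    Ideal.mem_span_singleton] at hx
  have h1 : (p : ℤ_[p]) ∣ y := (dvd_iff_dvd_of_dvd_sub h).1 hx
  exact PadicInt.prime_p.not_isUnit (isUnit_of_dvd_unit h1 hy)

theorem isUnit_of_not_p_dvd {x : ℤ_[p]} (h : ¬ (p : ℤ_[p]) ∣ x) : IsUnit x := by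
  by_contra hx
  rw [← mem_nonunits_iff, ← IsLocalRing.mem_maximalIdeal, PadicInt.maximalIdeal_eq_span_p,
    Ideal.mem_span_singleton] at hx
  exact h hx

theorem p_dvd_det_sub {n : ℕ} {A B : Matrix (Fin n) (Fin n) ℤ_[p]}
    (h : ∀ i j, (p : ℤ_[p]) ∣ A i j - B i j) : (p : ℤ_[p]) ∣ A.det - B.det := by
  rw [← Ideal.mem_span_singleton, ← Ideal.Quotient.eq, RingHom.map_det, RingHom.map_det]
  congr 1
  ext i j
  simp only [RingHom.mapMatrix_apply, map_apply]
  exact Ideal.Quotient.eq.2 (Ideal.mem_span_singleton.2 (h i j))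

theorem two_dvd_p_or_isUnit : (2 : ℤ_[p]) ∣ p ∧ p = 2 ∨ IsUnit (2 : ℤ_[p]) := by
  by_cases hp : p = 2
  · subst hp; exact Or.inl ⟨by norm_num, rfl⟩
  · right
    have : IsUnit ((2 : ℕ) : ℤ_[p]) :=
      PadicInt.isUnit_iff.2 (by
        rw [PadicInt.norm_natCast_eq_one_iff]
        exact (Nat.coprime_primes Fact.out Nat.prime_two).2 hp)
    exact_mod_cast this

theorem two_mul_dvd_p_mul (a : ℤ_[p]) : 2 * a ∣ p * a := by
  refine mul_dvd_mul_right ?_ a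
  rcases two_dvd_p_or_isUnit (p := p) with h | h
  · exact h.1
  · exact h.dvd

/-- The quadratic convergence of Newton's method for the equation `gᵀ S g = T`. -/
theorem exists_formDvd_succ {n : ℕ} {S T g : Matrix (Fin n) (Fin n) ℤ_[p]} (hS : Sᵀ = S)
    (hT : Tᵀ = T) (hSu : IsUnit S.det) (hgu : IsUnit g.det) {k : ℕ}
    (hk : 2 ≤ k ∨ 1 ≤ k ∧ IsUnit (2 : ℤ_[p]))
    (h : FormDvd ((p : ℤ_[p]) ^ k) (T - gᵀ * S * g)) :
    ∃ h : Matrix (Fin n) (Fin n) ℤ_[p], FormDvd ((p : ℤ_[p]) ^ (k + 1))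
      (T - (g + (p : ℤ_[p]) ^ k • h)ᵀ * S * (g + (p : ℤ_[p]) ^ k • h)) := by
  obtain ⟨Z, hZ⟩ := h.exists_add_transpose (pow_ne_zero _ PadicInt.prime_p.ne_zero)
    (isSymm_sub_conj hS hT g)
  refine ⟨(gᵀ * S)⁻¹ * Z, ?_⟩
  rw [sub_transpose_mul_mul_add_smul hS hSu hgu hZ]
  -- The new error carries the factor p^(2k). Its diagonal needs 2p^(k+1): this costs 2k ≥ k + 2
  -- when p = 2, but only 2k ≥ k + 1 when 2 is a unit.
  have h1 : 2 * (p : ℤ_[p]) ^ (k + 1) ∣ ((p : ℤ_[p]) ^ k) ^ 2 := by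
    rw [← pow_mul]
    rcases hk with hk | ⟨hk, h2⟩
    · refine (two_mul_dvd_p_mul _).trans ?_
      rw [← pow_succ']
      exact pow_dvd_pow _ (by lia)
    · rw [h2.mul_left_dvd]
      exact pow_dvd_pow _ (by lia)
  refine ⟨fun i j => ?_, fun i => ?_⟩
  · simp only [Matrix.neg_apply, Matrix.smul_apply, smul_eq_mul, dvd_neg]
    exact Dvd.dvd.mul_right ((dvd_mul_left _ _).trans h1) _
  · simp only [Matrix.neg_apply, Matrix.smul_apply, smul_eq_mul, dvd_neg]
    exact Dvd.dvd.mul_right h1 _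

theorem isClosed_setOf_dvd (a : ℤ_[p]) : IsClosed {x : ℤ_[p] | a ∣ x} := by
  have h : {x : ℤ_[p] | a ∣ x} = Set.range (fun x => a * x) := by
    ext x
    exact ⟨fun ⟨c, hc⟩ => ⟨c, hc.symm⟩, fun ⟨c, hc⟩ => ⟨c, hc.symm⟩⟩
  rw [h]
  exact (isCompact_range (continuous_const.mul continuous_id)).isClosed

theorem eq_zero_of_forall_pow_dvd {x : ℤ_[p]} (h : ∀ k, 2 ≤ k → (p : ℤ_[p]) ^ k ∣ x) :
    x = 0 := by
  by_contra hx
  have h1 := FiniteMultiplicity.of_not_isUnit (PadicInt.prime_p (p := p)).not_isUnit hx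
  obtain ⟨n, hn⟩ := h1
  exact hn ((pow_dvd_pow _ (by lia)).trans (h (n + 2) (by lia)))

/-- Hensel's lemma for the equation `gᵀ S g = T`. -/
theorem exists_transpose_mul_mul_eq {n : ℕ} {S T g : Matrix (Fin n) (Fin n) ℤ_[p]} (hS : Sᵀ = S)
    (hT : Tᵀ = T) (hSu : IsUnit S.det) (hgu : IsUnit g.det) {m : ℕ}
    (hm : 2 ≤ m ∨ 1 ≤ m ∧ IsUnit (2 : ℤ_[p]))
    (h : FormDvd ((p : ℤ_[p]) ^ m) (T - gᵀ * S * g)) :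
    ∃ g' : Matrix (Fin n) (Fin n) ℤ_[p], (∀ i j, (p : ℤ_[p]) ∣ g' i j - g i j) ∧
      g'ᵀ * S * g' = T := by
  -- Compactness replaces a Cauchy sequence: the approximate solutions of growing precision form
  -- nested nonempty closed sets of a compact space, and a common point solves the equation exactly.
  set K : ℕ → Set (Matrix (Fin n) (Fin n) ℤ_[p]) := fun k =>
    {g' | (∀ i j, (p : ℤ_[p]) ∣ g' i j - g i j) ∧
      FormDvd ((p : ℤ_[p]) ^ (m + k)) (T - g'ᵀ * S * g')} with hK
  have hcl : ∀ k, IsClosed (K k) := by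
    intro k
    have hc : Continuous fun g' : Matrix (Fin n) (Fin n) ℤ_[p] => T - g'ᵀ * S * g' := by fun_prop
    have hc1 : ∀ i j, Continuous fun g' : Matrix (Fin n) (Fin n) ℤ_[p] => g' i j :=
      fun i j => continuous_apply_apply i j
    have e : K k = (⋂ i, ⋂ j, {g' | (p : ℤ_[p]) ∣ g' i j - g i j}) ∩
        ((⋂ i, ⋂ j, {g' | (p : ℤ_[p]) ^ (m + k) ∣ (T - g'ᵀ * S * g') i j}) ∩
        (⋂ i, {g' | 2 * (p : ℤ_[p]) ^ (m + k) ∣ (T - g'ᵀ * S * g') i i})) := by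
      ext g'
      simp only [hK, FormDvd, Set.mem_ofPred_eq, Set.mem_inter_iff, Set.mem_iInter]
    rw [e]
    refine IsClosed.inter (isClosed_iInter fun i => isClosed_iInter fun j => ?_)
      (IsClosed.inter (isClosed_iInter fun i => isClosed_iInter fun j => ?_)
        (isClosed_iInter fun i => ?_))
    · exact (isClosed_setOf_dvd _).preimage ((hc1 i j).sub continuous_const)
    · exact (isClosed_setOf_dvd _).preimage ((hc1 i j).comp hc)
    · exact (isClosed_setOf_dvd _).preimage ((hc1 i i).comp hc)
  have hne : ∀ k, (K k).Nonempty := by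
    intro k
    induction k with
    | zero => exact ⟨g, fun i j => by simp, h⟩
    | succ k ih =>
      obtain ⟨g', h1, h2⟩ := ih
      have hgu' : IsUnit g'.det := isUnit_of_p_dvd_sub (p_dvd_det_sub h1) hgu
      obtain ⟨r, hr⟩ := exists_formDvd_succ hS hT hSu hgu' (k := m + k)
        (hm.imp (fun h => by lia) (fun h => ⟨by lia, h.2⟩)) h2
      refine ⟨_, fun i j => ?_, hr⟩
      have e : (g' + (p : ℤ_[p]) ^ (m + k) • r) i j - g i j
          = (g' i j - g i j) + (p : ℤ_[p]) ^ (m + k) * r i j := by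
        simp only [Matrix.add_apply, Matrix.smul_apply, smul_eq_mul]
        ring
      rw [e]
      exact dvd_add (h1 i j) (Dvd.dvd.mul_right (dvd_pow_self _ (by lia)) _)
  have hanti : ∀ k, K (k + 1) ⊆ K k := by
    intro k g' hg'
    have hp : (p : ℤ_[p]) ^ (m + k) ∣ (p : ℤ_[p]) ^ (m + (k + 1)) := pow_dvd_pow _ (by lia)
    exact ⟨hg'.1, fun i j => hp.trans (hg'.2.1 i j),
      fun i => (mul_dvd_mul_left 2 hp).trans (hg'.2.2 i)⟩
  have hcompact : CompactSpace (Matrix (Fin n) (Fin n) ℤ_[p]) :=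
    inferInstanceAs (CompactSpace (Fin n → Fin n → ℤ_[p]))
  obtain ⟨g', hg'⟩ := IsCompact.nonempty_iInter_of_sequence_nonempty_isCompact_isClosed K hanti
    hne (hcl 0).isCompact hcl
  rw [Set.mem_iInter] at hg'
  refine ⟨g', (hg' 0).1, ?_⟩
  refine (sub_eq_zero.1 ?_).symm
  ext i j
  refine eq_zero_of_forall_pow_dvd fun k _ => ?_
  exact (pow_dvd_pow _ (by lia)).trans ((hg' k).2.1 i j)

end HenselMatrix

end PadicLattice

namespace PadicLattice

open Matrix

/-! ### Characteristic vectors modulo 8, and lifting isometries from ℤ/p to ℤ_p. -/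

section HenselIsometry

theorem transpose_sub_smul_vecMulVec {R ι : Type*} [CommRing R] {S : Matrix ι ι R} (hS : Sᵀ = S)
    (c : R) (a : ι → R) : (S - c • vecMulVec a a)ᵀ = S - c • vecMulVec a a := by
  rw [transpose_sub, transpose_smul, transpose_vecMulVec, hS]

/-- If `g` is an isometry modulo `2`, up to the square of a linear form, then characteristic
vectors `u` of the source and `g u` of the target have the same value modulo `8`. -/
theorem eight_dvd_of_characteristic {n : ℕ} {S g : Matrix (Fin n) (Fin n) ℤ_[2]} (hS : Sᵀ = S)
    (hSu : IsUnit S.det) {a : Fin n → ℤ_[2]} {e : ℤ_[2]} (he : IsUnit e)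
    (h : FormDvd 2 (S - (2 * e) • vecMulVec a a - gᵀ * S * g)) {u : Fin n → ℤ_[2]}
    (hu : (S * g) *ᵥ u = S.diag) :
    8 ∣ u ⬝ᵥ (S - (2 * e) • vecMulVec a a - gᵀ * S * g) *ᵥ u := by
  -- This w = gu is characteristic for S: wᵀSx = diag S · x ≡ xᵀSx mod 2.
  set w := S⁻¹ *ᵥ S.diag with hw
  have hSw : S *ᵥ w = S.diag := by
    rw [hw, mulVec_mulVec, mul_nonsing_inv _ hSu, one_mulVec]
  have hgu : g *ᵥ u = w := by
    rw [hw, ← hu, mulVec_mulVec, ← Matrix.mul_assoc, nonsing_inv_mul _ hSu, Matrix.one_mul]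
  clear_value w
  set D := S - (2 * e) • vecMulVec a a - gᵀ * S * g with hD
  have h4 : 4 ∣ u ⬝ᵥ D *ᵥ u := by
    obtain ⟨Z, hZ⟩ := h.exists_add_transpose two_ne_zero
      (isSymm_sub_conj hS (transpose_sub_smul_vecMulVec hS _ _) g)
    rw [hD, ← hZ, smul_mulVec, dotProduct_smul, add_mulVec, dotProduct_add, mulVec_transpose,
      dotProduct_comm u (u ᵥ* Z), ← dotProduct_mulVec, ← two_mul, smul_eq_mul, ← mul_assoc]
    exact ⟨u ⬝ᵥ Z *ᵥ u, by norm_num⟩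
  have hDu : D *ᵥ u = S *ᵥ u - (2 * e * (a ⬝ᵥ u)) • a - gᵀ *ᵥ S.diag := by
    rw [hD, sub_mulVec, sub_mulVec, smul_mulVec, vecMulVec_mulVec, Matrix.mul_assoc,
      ← mulVec_mulVec u gᵀ, hu]
    congr 2
    ext i
    simp only [Pi.smul_apply, MulOpposite.smul_eq_mul_unop, smul_eq_mul, MulOpposite.unop_op]
    ring
  have hval : u ⬝ᵥ D *ᵥ u = u ⬝ᵥ S *ᵥ u - w ⬝ᵥ S.diag - 2 * (e * (a ⬝ᵥ u) ^ 2) := by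
    rw [hDu, dotProduct_sub, dotProduct_sub, dotProduct_smul, mulVec_transpose,
      dotProduct_comm u (S.diag ᵥ* g), ← dotProduct_mulVec, hgu, dotProduct_comm u a,
      dotProduct_comm w, smul_eq_mul]
    ring
  -- The vector u is characteristic for S modulo 2 too: Su ≡ gᵀ diag S, whose entries are congruent
  -- to the diagonal of gᵀSg, hence to that of S.
  have h2 : ∀ i, 2 ∣ (S *ᵥ u) i - S.diag i := by
    intro i
    have e1 : 2 ∣ (D *ᵥ u) i := by
      rw [mulVec, dotProduct]
      exact Finset.dvd_sum fun j _ => Dvd.dvd.mul_right (h.1 i j) _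
    have e2 := h.1 i i
    have e3 := two_dvd_dotProduct_mulVec_sub hS (fun j => g j i)
    have e4 : (gᵀ * S * g) i i = (fun j => g j i) ⬝ᵥ S *ᵥ (fun j => g j i) := by
      rw [Matrix.mul_assoc]
      rfl
    have e5 : (gᵀ *ᵥ S.diag) i = S.diag ⬝ᵥ (fun j => g j i) := by
      rw [mulVec_transpose]
      rfl
    rw [hDu] at e1
    simp only [Pi.sub_apply, Pi.smul_apply, smul_eq_mul, e5] at e1
    rw [hD, Matrix.sub_apply, Matrix.sub_apply, e4, Matrix.smul_apply, smul_eq_mul] at e2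
    obtain ⟨x, hx⟩ := e1
    obtain ⟨y, hy⟩ := e2
    obtain ⟨z, hz⟩ := e3
    refine ⟨x + e * (a ⬝ᵥ u) * a i - y - z - e * vecMulVec a a i i, ?_⟩
    rw [diag_apply]
    linear_combination hx - hy - hz
  choose y hy using h2
  have hy' : S *ᵥ u - S.diag = (2 : ℤ_[2]) • y := funext hy
  set v := S⁻¹ *ᵥ y with hv
  have huv : u = w + (2 : ℤ_[2]) • v := by
    have e1 : S⁻¹ *ᵥ (S *ᵥ u - S.diag) = u - w := by
      rw [← hSw, mulVec_sub, mulVec_mulVec, mulVec_mulVec, nonsing_inv_mul _ hSu, one_mulVec,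
        one_mulVec]
    rw [hy', mulVec_smul, ← hv] at e1
    rw [e1]
    abel
  clear_value v
  -- With u = w + 2v the difference is 4(wᵀSv + vᵀSv), and the bracket is even because w is
  -- characteristic.
  have h8 : 8 ∣ u ⬝ᵥ S *ᵥ u - w ⬝ᵥ S.diag := by
    obtain ⟨c, hc⟩ := two_dvd_dotProduct_mulVec_sub hS v
    have e1 : w ⬝ᵥ S *ᵥ v = S.diag ⬝ᵥ v := by
      rw [← hSw, dotProduct_mulVec, ← mulVec_transpose, hS]
    refine ⟨c + S.diag ⬝ᵥ v, ?_⟩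
    rw [huv, mulVec_add, mulVec_smul, dotProduct_add, add_dotProduct, add_dotProduct, hSw,
      dotProduct_smul, dotProduct_smul, smul_dotProduct, smul_dotProduct, e1,
      dotProduct_comm v S.diag]
    simp only [smul_eq_mul]
    linear_combination 4 * hc
  -- Divisibility of uᵀDu by 4 is automatic from `FormDvd`. Combined with `h8` it makes e(a·u)²
  -- even, so the term 2e(a·u)² is in fact divisible by 8.
  have hau : 2 ∣ a ⬝ᵥ u := by
    obtain ⟨x, hx⟩ := h4
    obtain ⟨y, hy⟩ := h8
    have e1 : 2 ∣ e * (a ⬝ᵥ u) ^ 2 := by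
      refine ⟨2 * y - x, mul_left_cancel₀ two_ne_zero ?_⟩
      linear_combination hy + hval - hx
    rw [he.dvd_mul_left] at e1
    have hp : Prime (2 : ℤ_[2]) := by exact_mod_cast PadicInt.prime_p (p := 2)
    exact hp.dvd_of_dvd_pow e1
  rw [hval]
  obtain ⟨x, hx⟩ := hau
  refine dvd_sub h8 ⟨e * x ^ 2, ?_⟩
  rw [hx]
  ring

variable {p : ℕ} [Fact p.Prime]

/-- Lifting of isometries of a unimodular form from `ℤ / p` to `ℤ_p`, up to the square of a
prescribed linear form. -/
theorem exists_lift_isometry {n : ℕ} {S g : Matrix (Fin n) (Fin n) ℤ_[p]} (hS : Sᵀ = S)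
    (hSu : IsUnit S.det) (hgu : IsUnit g.det) {a : Fin n → ℤ_[p]} {e : ℤ_[p]} (he : IsUnit e)
    (h : FormDvd (p : ℤ_[p]) (S - (2 * e) • vecMulVec a a - gᵀ * S * g)) :
    ∃ g' : Matrix (Fin n) (Fin n) ℤ_[p], (∀ i j, (p : ℤ_[p]) ∣ g' i j - g i j) ∧
      g'ᵀ * S * g' = S - (2 * e) • vecMulVec a a := by
  have hT := transpose_sub_smul_vecMulVec hS (2 * e) a
  rcases two_dvd_p_or_isUnit (p := p) with ⟨-, rfl⟩ | h2
  · have e2 : ((2 : ℕ) : ℤ_[2]) = 2 := by norm_num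
    simp only [e2] at h ⊢
    have hu : (S * g) *ᵥ ((S * g)⁻¹ *ᵥ S.diag) = S.diag := by
      rw [mulVec_mulVec, mul_nonsing_inv, one_mulVec]
      rw [det_mul]
      exact hSu.mul hgu
    -- For p = 2 the general Newton step needs precision 4 to start, so one special step is made
    -- first.
    obtain ⟨k, hk⟩ := exists_formDvd_four hS hT hSu hgu h hu
      (eight_dvd_of_characteristic hS hSu he h hu)
    have hd : ∀ i j, ((2 : ℕ) : ℤ_[2]) ∣ (g + (2 : ℤ_[2]) • k) i j - g i j := fun i j =>
      ⟨k i j, by simp⟩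
    obtain ⟨g', h1, h2⟩ := exists_transpose_mul_mul_eq hS hT hSu
      (isUnit_of_p_dvd_sub (p_dvd_det_sub hd) hgu) (m := 2) (Or.inl le_rfl)
      (by rw [e2]; norm_num; exact hk)
    refine ⟨g', fun i j => ?_, h2⟩
    rw [← e2, ← sub_add_sub_cancel]
    exact dvd_add (h1 i j) (hd i j)
  · exact exists_transpose_mul_mul_eq hS hT hSu hgu (m := 1) (Or.inr ⟨le_rfl, h2⟩)
      (by rwa [pow_one])

end HenselIsometry

end PadicLattice

namespace PadicLattice

/-! ### Modular sublattices and existence of Jordan decompositions. -/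

section Jordan

variable {p : ℕ} [Fact p.Prime] {L : Type*} [AddCommGroup L] [Module ℤ_[p] L]

theorem mul_zpow_mem_fracIdeal (c : ℤ_[p]) (k : ℤ) :
    (c : ℚ_[p]) * (p : ℚ_[p]) ^ k ∈ fracIdeal p k :=
  mem_fracIdeal.2 ⟨c, rfl⟩

theorem coe_smul_eq_mul (c : ℤ_[p]) (x : ℚ_[p]) : c • x = (c : ℚ_[p]) * x := rfl

theorem mul_zpow_right_cancel {k : ℤ} {c d : ℤ_[p]}
    (h : (c : ℚ_[p]) * (p : ℚ_[p]) ^ k = d * (p : ℚ_[p]) ^ k) : c = d :=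
  Subtype.coe_injective (mul_right_cancel₀ (zpow_ne_zero _ p_ne_zero) h)

theorem dvd_of_mul_zpow_mem {k : ℤ} {c : ℤ_[p]}
    (h : (c : ℚ_[p]) * (p : ℚ_[p]) ^ k ∈ fracIdeal p (k + 1)) : (p : ℤ_[p]) ∣ c := by
  obtain ⟨d, hd⟩ := mem_fracIdeal.1 h
  refine ⟨d, mul_zpow_right_cancel (k := k) ?_⟩
  rw [← hd, zpow_add₀ p_ne_zero]
  push_cast
  rw [zpow_one]
  ring

theorem mul_zpow_mem_of_dvd {k : ℤ} {c : ℤ_[p]} (h : (p : ℤ_[p]) ∣ c) :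
    (c : ℚ_[p]) * (p : ℚ_[p]) ^ k ∈ fracIdeal p (k + 1) := by
  obtain ⟨d, rfl⟩ := h
  refine mem_fracIdeal.2 ⟨d, ?_⟩
  rw [zpow_add₀ p_ne_zero]
  push_cast
  rw [zpow_one]
  ring

theorem exists_mem_fracIdeal (x : ℚ_[p]) : ∃ k, x ∈ fracIdeal p k := by
  by_cases hx : x = 0
  · exact ⟨0, hx ▸ zero_mem _⟩
  · have h0 : (p : ℚ_[p]) ^ x.valuation ≠ 0 := zpow_ne_zero _ p_ne_zero
    have h1 : ‖x * ((p : ℚ_[p]) ^ x.valuation)⁻¹‖ ≤ 1 := by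
      rw [norm_mul, norm_inv, Padic.norm_p_zpow, Padic.norm_eq_zpow_neg_valuation hx,
        mul_inv_cancel₀]
      exact zpow_ne_zero _ (Nat.cast_ne_zero.2 (Fact.out : p.Prime).ne_zero)
    exact ⟨x.valuation, mem_fracIdeal.2 ⟨⟨_, h1⟩, by simp only [inv_mul_cancel_right₀ h0]⟩⟩

theorem exists_notMem_fracIdeal {x : ℚ_[p]} (hx : x ≠ 0) :
    ∃ n, ∀ k, x ∈ fracIdeal p k → k ≤ n := by
  obtain ⟨n, c, hc⟩ := (exists_mem_fracIdeal x⁻¹).imp fun _ h => mem_fracIdeal.1 h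
  refine ⟨-n, fun k hk => ?_⟩
  obtain ⟨d, hd⟩ := mem_fracIdeal.1 hk
  by_contra hlt
  push Not at hlt
  obtain ⟨m, hm⟩ := Int.le.dest (Int.add_one_le_iff.2 hlt)
  have h1 : (c * d * (p : ℤ_[p]) ^ (m + 1)) = 1 := by
    refine Subtype.coe_injective ?_
    change ((c * d * (p : ℤ_[p]) ^ (m + 1) : ℤ_[p]) : ℚ_[p]) = ((1 : ℤ_[p]) : ℚ_[p])
    push_cast
    rw [← mul_inv_cancel₀ hx, ← hc, ← hd, ← zpow_natCast]
    have : (p : ℚ_[p]) ^ ((m + 1 : ℕ) : ℤ) = (p : ℚ_[p]) ^ k * (p : ℚ_[p]) ^ n := by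
      rw [← zpow_add₀ p_ne_zero]
      congr 1
      push_cast
      lia
    rw [this]
    ring
  have h2 : (p : ℤ_[p]) ∣ 1 := h1 ▸ Dvd.dvd.mul_left (dvd_pow_self _ (by lia)) _
  exact PadicInt.prime_p.not_isUnit (isUnit_of_dvd_one h2)

/-- A `ℚ_p`-valued linear map with values in `p ^ k ℤ_p` is `p ^ k` times a linear form. -/
theorem exists_linearMap_mul_zpow {M : Type*} [AddCommGroup M] [Module ℤ_[p] M]
    (f : M →ₗ[ℤ_[p]] ℚ_[p]) {k : ℤ} (hf : ∀ y, f y ∈ fracIdeal p k) :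
    ∃ φ : M →ₗ[ℤ_[p]] ℤ_[p], ∀ y, f y = φ y * (p : ℚ_[p]) ^ k := by
  choose c hc using fun y => mem_fracIdeal.1 (hf y)
  refine ⟨⟨⟨c, fun x y => mul_zpow_right_cancel (k := k) ?_⟩,
    fun a x => mul_zpow_right_cancel (k := k) ?_⟩, fun y => (hc y).symm⟩
  · rw [hc, map_add, ← hc, ← hc]
    push_cast
    ring
  · rw [hc, map_smul, ← hc, coe_smul_eq_mul]
    simp only [RingHom.id_apply, smul_eq_mul]
    push_cast
    ring

/-- The submodule of `L` orthogonal to a submodule `M`. -/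
def orthoSub (q : QuadraticMap ℤ_[p] L ℚ_[p]) (M : Submodule ℤ_[p] L) :
    Submodule ℤ_[p] L where
  carrier := {x | ∀ y ∈ M, QuadraticMap.polar q x y = 0}
  zero_mem' := fun y _ => by simp
  add_mem' := fun {x x'} hx hx' y hy => by
    rw [QuadraticMap.polar_add_left, hx y hy, hx' y hy, add_zero]
  smul_mem' := fun a x hx y hy => by
    rw [QuadraticMap.polar_smul_left, hx y hy, smul_zero]

/-- The submodule `M` of `L` is `p ^ k`-modular: `b` is `p ^ k ℤ_p`-valued on `M`, and every
linear form on `M` has the shape `p ^ (-k) b(x, ·)`. -/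
def IsModular (q : QuadraticMap ℤ_[p] L ℚ_[p]) (M : Submodule ℤ_[p] L) (k : ℤ) : Prop :=
  (∀ x ∈ M, ∀ y ∈ M, QuadraticMap.polar q x y ∈ fracIdeal p k) ∧
    ∀ φ : M →ₗ[ℤ_[p]] ℤ_[p], ∃ x ∈ M, ∀ y : M,
      QuadraticMap.polar q x (y : L) = φ y * (p : ℚ_[p]) ^ k

theorem polar_sum_smul_left (q : QuadraticMap ℤ_[p] L ℚ_[p]) {ι : Type*} (s : Finset ι)
    (c : ι → ℤ_[p]) (w : ι → L) (y : L) :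
    QuadraticMap.polar q (∑ i ∈ s, c i • w i) y
      = ∑ i ∈ s, (c i : ℚ_[p]) * QuadraticMap.polar q (w i) y := by
  rw [QuadraticMap.polar_comm, polar_sum_right]
  refine Finset.sum_congr rfl fun i _ => ?_
  rw [QuadraticMap.polar_smul_right, QuadraticMap.polar_comm, coe_smul_eq_mul]

theorem isModular_span {q : QuadraticMap ℤ_[p] L ℚ_[p]} {n : ℕ} {w : Fin n → L}
    {G : Matrix (Fin n) (Fin n) ℤ_[p]} {k : ℤ}
    (hG : ∀ i j, QuadraticMap.polar q (w i) (w j) = G i j * (p : ℚ_[p]) ^ k)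
    (hdet : IsUnit G.det) : IsModular q (Submodule.span ℤ_[p] (Set.range w)) k := by
  constructor
  · intro x hx y hy
    obtain ⟨c, rfl⟩ := (Submodule.mem_span_range_iff_exists_fun _).1 hx
    obtain ⟨d, rfl⟩ := (Submodule.mem_span_range_iff_exists_fun _).1 hy
    rw [polar_sum_right]
    refine sum_mem fun j _ => ?_
    rw [QuadraticMap.polar_smul_right, polar_sum_smul_left]
    refine Submodule.smul_mem _ _ (sum_mem fun i _ => ?_)
    rw [hG, ← coe_smul_eq_mul]
    exact Submodule.smul_mem _ _ (mul_zpow_mem_fracIdeal _ _)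
  · intro φ
    set c : Fin n → ℤ_[p] := fun i => φ ⟨w i, Submodule.subset_span ⟨i, rfl⟩⟩ with hc
    set d := Matrix.vecMul c G⁻¹ with hd
    have hdG : Matrix.vecMul d G = c := by
      rw [hd, Matrix.vecMul_vecMul, Matrix.nonsing_inv_mul _ hdet, Matrix.vecMul_one]
    refine ⟨∑ i, d i • w i, sum_mem fun i _ => Submodule.smul_mem _ _
      (Submodule.subset_span ⟨i, rfl⟩), ?_⟩
    rintro ⟨y, hy⟩
    obtain ⟨t, rfl⟩ := (Submodule.mem_span_range_iff_exists_fun _).1 hy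
    have h1 : φ ⟨∑ i, t i • w i, hy⟩ = ∑ i, t i * c i := by
      have : (⟨∑ i, t i • w i, hy⟩ : Submodule.span ℤ_[p] (Set.range w))
          = ∑ i, t i • ⟨w i, Submodule.subset_span ⟨i, rfl⟩⟩ :=
        Subtype.ext (by simp)
      rw [this, map_sum]
      simp only [map_smul, smul_eq_mul, hc]
    rw [h1, PadicInt.coe_sum, polar_sum_right, Finset.sum_mul]
    refine Finset.sum_congr rfl fun j _ => ?_
    rw [QuadraticMap.polar_smul_right, polar_sum_smul_left, coe_smul_eq_mul, ← hdG]
    simp only [hG, Matrix.vecMul, dotProduct]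
    push_cast
    rw [PadicInt.coe_sum, Finset.mul_sum, Finset.mul_sum, Finset.sum_mul]
    push_cast
    exact Finset.sum_congr rfl fun i _ => by ring

/-- Vectors representing the coordinate forms of a basis are the rows of a left inverse of the Gram
matrix. -/
theorem IsModular.isUnimodular [Module.Free ℤ_[p] L] [Module.Finite ℤ_[p] L]
    {q : QuadraticMap ℤ_[p] L ℚ_[p]} {M : Submodule ℤ_[p] L} {k : ℤ} (h : IsModular q M k) :
    IsUnimodular (rescale q M k) := by
  have h0 : (p : ℚ_[p]) ^ k ≠ 0 := zpow_ne_zero _ p_ne_zero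
  set v := Module.finBasis ℤ_[p] M with hv
  choose G hG using fun i j => mem_fracIdeal.1 (h.1 (v i) (v i).2 (v j) (v j).2)
  refine ⟨_, v, Matrix.of G, fun i j => ?_, ?_⟩
  · rw [polar_rescale, ← hG, zpow_neg, Matrix.of_apply]
    field_simp
  · choose x hxM hx using fun j => h.2 (v.coord j)
    have h1 : (Matrix.of fun j i => v.repr ⟨x j, hxM j⟩ i) * Matrix.of G = 1 := by
      ext j l
      rw [Matrix.mul_apply]
      refine mul_zpow_right_cancel (k := k) ?_
      rw [Matrix.one_apply, PadicInt.coe_sum, Finset.sum_mul]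
      have h2 := hx j (v l)
      have h3 : x j = ∑ i, v.repr ⟨x j, hxM j⟩ i • (v i : L) := by
        conv_lhs => rw [← Subtype.coe_mk (x j) (hxM j), ← v.sum_repr ⟨x j, hxM j⟩]
        simp only [Submodule.coe_sum, Submodule.coe_smul]
      rw [h3, polar_sum_smul_left, Basis.coord_apply, Basis.repr_self,
        Finsupp.single_apply] at h2
      simp only [eq_comm (a := j)]
      rw [← h2]
      refine Finset.sum_congr rfl fun i _ => ?_
      rw [Matrix.of_apply, Matrix.of_apply, ← hG]
      push_cast
      ring
    exact Matrix.isUnit_det_of_left_inverse h1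

/-- Modularity represents the form b(x, ·) on M by a vector m of M; this m is the orthogonal
projection of x. -/
theorem IsModular.exists_sub_mem_orthoSub {q : QuadraticMap ℤ_[p] L ℚ_[p]}
    {M : Submodule ℤ_[p] L} {k : ℤ} (h : IsModular q M k) {x : L}
    (hx : ∀ y ∈ M, QuadraticMap.polar q x y ∈ fracIdeal p k) : ∃ m ∈ M, x - m ∈ orthoSub q M := by
  obtain ⟨φ, hφ⟩ := exists_linearMap_mul_zpow ((QuadraticMap.polarBilin q x).comp M.subtype)
    (fun y => hx y y.2)
  obtain ⟨m, hm, hmy⟩ := h.2 φ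
  refine ⟨m, hm, fun y hy => ?_⟩
  have h1 := hφ ⟨y, hy⟩
  rw [← hmy ⟨y, hy⟩] at h1
  rw [QuadraticMap.polar_sub_left]
  exact sub_eq_zero.2 h1

theorem IsModular.sup {q : QuadraticMap ℤ_[p] L ℚ_[p]} {M N : Submodule ℤ_[p] L} {k : ℤ}
    (hM : IsModular q M k) (hN : IsModular q N k)
    (hMN : ∀ x ∈ M, ∀ y ∈ N, QuadraticMap.polar q x y = 0) : IsModular q (M ⊔ N) k := by
  constructor
  · intro x hx y hy
    obtain ⟨a, ha, b, hb, rfl⟩ := Submodule.mem_sup.1 hx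
    obtain ⟨c, hc, d, hd, rfl⟩ := Submodule.mem_sup.1 hy
    rw [QuadraticMap.polar_add_left, QuadraticMap.polar_add_right, QuadraticMap.polar_add_right,
      hMN a ha d hd, QuadraticMap.polar_comm q b c, hMN c hc b hb, add_zero, zero_add]
    exact add_mem (hM.1 a ha c hc) (hN.1 b hb d hd)
  · intro φ
    obtain ⟨x, hx, hxy⟩ := hM.2 (φ.comp (Submodule.inclusion le_sup_left))
    obtain ⟨y, hy, hyx⟩ := hN.2 (φ.comp (Submodule.inclusion le_sup_right))
    refine ⟨x + y, Submodule.add_mem_sup hx hy, ?_⟩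
    rintro ⟨z, hz⟩
    obtain ⟨c, hc, d, hd, rfl⟩ := Submodule.mem_sup.1 hz
    have h1 : φ ⟨c + d, hz⟩ = φ (Submodule.inclusion le_sup_left ⟨c, hc⟩)
        + φ (Submodule.inclusion le_sup_right ⟨d, hd⟩) := by
      rw [← map_add]
      rfl
    have h2 := hxy ⟨c, hc⟩
    have h3 := hyx ⟨d, hd⟩
    simp only [LinearMap.comp_apply] at h2 h3
    rw [h1, QuadraticMap.polar_add_left, QuadraticMap.polar_add_right,
      QuadraticMap.polar_add_right, hMN x hx d hd, QuadraticMap.polar_comm q y c, hMN c hc y hy,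
      add_zero, zero_add, h2, h3]
    push_cast
    ring

theorem isModular_bot (q : QuadraticMap ℤ_[p] L ℚ_[p]) (k : ℤ) : IsModular q ⊥ k := by
  constructor
  · intro x hx y _
    rw [(Submodule.mem_bot _).1 hx, QuadraticMap.polar_zero_left]
    exact zero_mem _
  · intro φ
    refine ⟨0, zero_mem _, fun y => ?_⟩
    rw [Subsingleton.elim y 0]
    simp

theorem IsModular.eq_bot [Module.Free ℤ_[p] L] [Module.Finite ℤ_[p] L]
    {q : QuadraticMap ℤ_[p] L ℚ_[p]} {M : Submodule ℤ_[p] L} {k : ℤ} (h : IsModular q M k)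
    (h1 : ∀ x ∈ M, ∀ y ∈ M, QuadraticMap.polar q x y ∈ fracIdeal p (k + 1)) : M = ⊥ := by
  have hv := Module.finBasis ℤ_[p] M
  have hn : finrank ℤ_[p] M = 0 := by
    by_contra hn
    set i : Fin (finrank ℤ_[p] M) := ⟨0, Nat.pos_of_ne_zero hn⟩
    obtain ⟨x, hx, hxy⟩ := h.2 (hv.coord i)
    have h2 := h1 x hx (hv i) (hv i).2
    rw [hxy] at h2
    have h3 := dvd_of_mul_zpow_mem h2
    rw [Basis.coord_apply, Basis.repr_self, Finsupp.single_eq_same] at h3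
    exact PadicInt.prime_p.not_isUnit (isUnit_of_dvd_one h3)
  exact Submodule.finrank_eq_zero.1 hn

/-- A maximal `p ^ k`-modular submodule of a lattice of scale `p ^ k` splits off, and its
complement has a smaller scale. -/
theorem exists_isModular_forall_mem [Module.Finite ℤ_[p] L]
    {q : QuadraticMap ℤ_[p] L ℚ_[p]} {E : Submodule ℤ_[p] L} {k : ℤ}
    (hE : ∀ x ∈ E, ∀ y ∈ E, QuadraticMap.polar q x y ∈ fracIdeal p k) :
    ∃ M ≤ E, IsModular q M k ∧ ∀ x ∈ E ⊓ orthoSub q M, ∀ y ∈ E ⊓ orthoSub q M,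
      QuadraticMap.polar q x y ∈ fracIdeal p (k + 1) := by
  obtain ⟨M, ⟨hME, hM⟩, hmax⟩ := set_has_maximal_iff_noetherian.2
    (inferInstance : IsNoetherian ℤ_[p] L) {M | M ≤ E ∧ IsModular q M k}
    ⟨⊥, bot_le, isModular_bot q k⟩
  refine ⟨M, hME, hM, ?_⟩
  -- Maximality of M: a p^k-modular span orthogonal to M can be added to it, so it already lies in
  -- M. Its vectors are then orthogonal to themselves, which forces the values considered below to
  -- vanish.
  have hext : ∀ (n : ℕ) (w : Fin n → L) (G : Matrix (Fin n) (Fin n) ℤ_[p]),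
      (∀ i, w i ∈ E ⊓ orthoSub q M) →
      (∀ i j, QuadraticMap.polar q (w i) (w j) = G i j * (p : ℚ_[p]) ^ k) →
      IsUnit G.det → ∀ i, w i ∈ M := by
    intro n w G hw hG hdet i
    have h1 : Submodule.span ℤ_[p] (Set.range w) ≤ E ⊓ orthoSub q M :=
      Submodule.span_le.2 (by rintro _ ⟨j, rfl⟩; exact hw j)
    have h2 : IsModular q (M ⊔ Submodule.span ℤ_[p] (Set.range w)) k :=
      hM.sup (isModular_span hG hdet) fun x hx y hy => by
        rw [QuadraticMap.polar_comm]
        exact (h1 hy).2 x hx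
    have h3 := hmax _ ⟨sup_le hME (h1.trans inf_le_left), h2⟩
    have h4 : Submodule.span ℤ_[p] (Set.range w) ≤ M := by
      by_contra hcon
      exact h3 (lt_of_le_of_ne le_sup_left fun e => hcon (e ▸ le_sup_right))
    exact h4 (Submodule.subset_span ⟨i, rfl⟩)
  have hself : ∀ x ∈ E ⊓ orthoSub q M, QuadraticMap.polar q x x ∈ fracIdeal p (k + 1) := by
    intro x hx
    obtain ⟨c, hc⟩ := mem_fracIdeal.1 (hE x hx.1 x hx.1)
    rw [← hc]
    by_cases hd : (p : ℤ_[p]) ∣ c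
    · exact mul_zpow_mem_of_dvd hd
    · have h1 := hext 1 (fun _ => x) (Matrix.of fun _ _ => c) (fun _ => hx) (fun _ _ => hc.symm)
        (by rw [Matrix.det_fin_one, Matrix.of_apply]; exact isUnit_of_not_p_dvd hd) 0
      rw [hc, hx.2 x h1]
      exact zero_mem _
  intro x hx y hy
  obtain ⟨c, hc⟩ := mem_fracIdeal.1 (hE x hx.1 y hy.1)
  obtain ⟨a, ha⟩ := mem_fracIdeal.1 (hE x hx.1 x hx.1)
  obtain ⟨b, hb⟩ := mem_fracIdeal.1 (hE y hy.1 y hy.1)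
  rw [← hc]
  by_cases hd : (p : ℤ_[p]) ∣ c
  · exact mul_zpow_mem_of_dvd hd
  -- Since p divides a but not c, the determinant ab - c² of the plane spanned by x and y is a unit.
  · have hpa : (p : ℤ_[p]) ∣ a := dvd_of_mul_zpow_mem (k := k) (by rw [ha]; exact hself x hx)
    have h1 := hext 2 ![x, y] !![a, c; c, b] (fun i => by fin_cases i; exacts [hx, hy])
      (fun i j => by
        fin_cases i <;> fin_cases j
        · exact ha.symm
        · exact hc.symm
        · exact (QuadraticMap.polar_comm q y x).trans hc.symm
        · exact hb.symm)
      (by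
        rw [Matrix.det_fin_two_of]
        refine isUnit_of_not_p_dvd fun h => hd ?_
        have h2 := (dvd_sub_right (hpa.mul_right b)).1 h
        exact (PadicInt.prime_p.dvd_or_dvd h2).elim id id) 1
    rw [hc, hx.2 y h1]
    exact zero_mem _

theorem exists_polar_mem_fracIdeal [Module.Free ℤ_[p] L] [Module.Finite ℤ_[p] L]
    (q : QuadraticMap ℤ_[p] L ℚ_[p]) :
    ∃ k, ∀ x y, QuadraticMap.polar q x y ∈ fracIdeal p k := by
  have v := Module.finBasis ℤ_[p] L
  choose k hk using fun ij : Fin (finrank ℤ_[p] L) × Fin (finrank ℤ_[p] L) =>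
    exists_mem_fracIdeal (QuadraticMap.polar q (v ij.1) (v ij.2))
  obtain ⟨m, hm⟩ := (Finset.univ.image k).bddBelow
  refine ⟨m, fun x y => ?_⟩
  rw [← v.sum_repr x, ← v.sum_repr y, polar_sum_right]
  refine sum_mem fun j _ => ?_
  rw [QuadraticMap.polar_smul_right, polar_sum_smul_left]
  refine Submodule.smul_mem _ _ (sum_mem fun i _ => Submodule.smul_mem _ _ ?_)
  exact fracIdeal_anti (hm (Finset.mem_image_of_mem k (Finset.mem_univ (i, j))))
    (hk (i, j))

theorem exists_scale [Module.Free ℤ_[p] L] [Module.Finite ℤ_[p] L]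
    (q : QuadraticMap ℤ_[p] L ℚ_[p]) {E : Submodule ℤ_[p] L}
    (hE : ∃ x ∈ E, ∃ y ∈ E, QuadraticMap.polar q x y ≠ 0) :
    ∃ k, (∀ x ∈ E, ∀ y ∈ E, QuadraticMap.polar q x y ∈ fracIdeal p k) ∧
      ¬ ∀ x ∈ E, ∀ y ∈ E, QuadraticMap.polar q x y ∈ fracIdeal p (k + 1) := by
  obtain ⟨x, hx, y, hy, hxy⟩ := hE
  obtain ⟨n, hn⟩ := exists_notMem_fracIdeal hxy
  obtain ⟨m, hm⟩ := exists_polar_mem_fracIdeal q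
  obtain ⟨k, hk, hmax⟩ := Int.exists_greatest_of_bdd
    (P := fun k => ∀ x ∈ E, ∀ y ∈ E, QuadraticMap.polar q x y ∈ fracIdeal p k)
    ⟨n, fun k hk => hn k (hk x hx y hy)⟩ ⟨m, fun x _ y _ => hm x y⟩
  exact ⟨k, hk, fun h => by have := hmax _ h; lia⟩

/-- Induction on the rank: a maximal modular part for the scale p^k of E is nonzero and splits off,
leaving a nondegenerate complement of smaller rank. -/
theorem exists_orthogonal_family [Module.Free ℤ_[p] L] [Module.Finite ℤ_[p] L]
    (q : QuadraticMap ℤ_[p] L ℚ_[p]) (n : ℕ) : ∀ E : Submodule ℤ_[p] L,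
    finrank ℤ_[p] E = n →
    (∀ x ∈ E, (∀ y ∈ E, QuadraticMap.polar q x y = 0) → x = 0) →
    ∃ C : ℤ → Submodule ℤ_[p] L, ⨆ i, C i = E ∧
      (∀ i j, i ≠ j → ∀ x ∈ C i, ∀ y ∈ C j, QuadraticMap.polar q x y = 0) ∧
      ∀ i, IsModular q (C i) i := by
  induction n using Nat.strong_induction_on with
  | _ n ih =>
    intro E hn hE
    by_cases h0 : ∃ x ∈ E, ∃ y ∈ E, QuadraticMap.polar q x y ≠ 0
    swap
    · push Not at h0
      refine ⟨fun _ => ⊥, ?_, fun i j _ x hx y _ => ?_, isModular_bot q⟩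
      · rw [iSup_bot, eq_comm, Submodule.eq_bot_iff]
        exact fun x hx => hE x hx (h0 x hx)
      · rw [(Submodule.mem_bot _).1 hx, QuadraticMap.polar_zero_left]
    obtain ⟨k, hk, hk'⟩ := exists_scale q h0
    obtain ⟨M, hME, hM, hR⟩ := exists_isModular_forall_mem hk
    set R := E ⊓ orthoSub q M with hRdef
    have hsup : M ⊔ R = E := by
      refine le_antisymm (sup_le hME inf_le_left) fun x hx => ?_
      obtain ⟨m, hm, hxm⟩ := hM.exists_sub_mem_orthoSub fun y hy => hk x hx y (hME hy)
      exact Submodule.mem_sup.2 ⟨m, hm, x - m, ⟨sub_mem hx (hME hm), hxm⟩, by abel⟩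
    have hMR : ∀ x ∈ M, ∀ y ∈ R, QuadraticMap.polar q x y = 0 := fun x hx y hy => by
      rw [QuadraticMap.polar_comm]
      exact hy.2 x hx
    have hinf : M ⊓ R = ⊥ := by
      rw [Submodule.eq_bot_iff]
      rintro x ⟨hxM, hxR⟩
      refine hE x hxR.1 fun y hy => ?_
      rw [← hsup] at hy
      obtain ⟨a, ha, b, hb, rfl⟩ := Submodule.mem_sup.1 hy
      rw [QuadraticMap.polar_add_right, hxR.2 a ha, hMR x hxM b hb, add_zero]
    have hM0 : finrank ℤ_[p] M ≠ 0 := by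
      intro h
      have hMbot := Submodule.finrank_eq_zero.1 h
      rw [hMbot, bot_sup_eq] at hsup
      rw [hsup] at hR
      exact hk' hR
    have hrank : finrank ℤ_[p] R < n := by
      have h1 := LinearMap.finrank_le_finrank_of_injective
        (f := ((M.subtype.coprod R.subtype).codRestrict E fun x =>
          add_mem (hME x.1.2) x.2.2.1))
        ((injective_iff_map_eq_zero _).2 fun ⟨a, b⟩ hab => by
          have h2 : (a : L) + b = 0 := congrArg Subtype.val hab
          have h3 : (a : L) ∈ M ⊓ R := ⟨a.2, by
            rw [eq_neg_of_add_eq_zero_left h2]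
            exact neg_mem b.2⟩
          rw [hinf, Submodule.mem_bot] at h3
          rw [h3, zero_add] at h2
          exact Prod.ext (Subtype.ext h3) (Subtype.ext h2))
      rw [finrank_prod, hn] at h1
      lia
    obtain ⟨C, hC1, hC2, hC3⟩ := ih _ hrank R rfl fun x hx hxR => hE x hx.1 fun y hy => by
      rw [← hsup] at hy
      obtain ⟨a, ha, b, hb, rfl⟩ := Submodule.mem_sup.1 hy
      rw [QuadraticMap.polar_add_right, hx.2 a ha, hxR b hb, add_zero]
    have hCR : ∀ i, C i ≤ R := fun i => hC1 ▸ le_iSup C i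
    -- The complement has values in p^(k+1) ℤ_p, so its k-th slot is empty and can receive M.
    have hCk : C k = ⊥ := (hC3 k).eq_bot fun x hx y hy => hR x (hCR k hx) y (hCR k hy)
    refine ⟨Function.update C k M, ?_, ?_, ?_⟩
    · refine le_antisymm (iSup_le fun i => ?_) ?_
      · by_cases hi : i = k
        · subst hi
          rw [Function.update_self]
          exact hME
        · rw [Function.update_of_ne hi]
          exact (hCR i).trans inf_le_left
      · rw [← hsup, ← hC1]
        refine sup_le ?_ (iSup_le fun i => ?_)
        · conv_lhs => rw [← Function.update_self k M C]
          exact le_iSup (Function.update C k M) k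
        · by_cases hi : i = k
          · rw [hi, hCk]
            exact bot_le
          · conv_lhs => rw [← Function.update_of_ne hi M C]
            exact le_iSup (Function.update C k M) i
    · intro i j hij x hx y hy
      by_cases hi : i = k
      · subst hi
        rw [Function.update_self] at hx
        rw [Function.update_of_ne hij.symm] at hy
        exact hMR x hx y (hCR j hy)
      · rw [Function.update_of_ne hi] at hx
        by_cases hj : j = k
        · subst hj
          rw [Function.update_self] at hy
          exact (hCR i hx).2 y hy
        · rw [Function.update_of_ne hj] at hy
          exact hC2 i j hij x hx y hy
    · intro i
      by_cases hi : i = k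
      · subst hi
        rwa [Function.update_self]
      · rw [Function.update_of_ne hi]
        exact hC3 i

/-- Every non-degenerate `ℤ_p`-lattice has a Jordan decomposition. -/
theorem nonempty_jordanDecomposition [Module.Free ℤ_[p] L] [Module.Finite ℤ_[p] L]
    {q : QuadraticMap ℤ_[p] L ℚ_[p]} (hq : IsNondegenerate q) :
    Nonempty (JordanDecomposition q) := by
  obtain ⟨C, h1, h2, h3⟩ := exists_orthogonal_family q _ ⊤ rfl
    (fun x _ hx => hq x fun y => hx y trivial)
  refine ⟨⟨C, ?_, h2, fun i => (h3 i).isUnimodular⟩⟩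
  rw [DirectSum.isInternal_submodule_iff_iSupIndep_and_iSup_eq_top]
  refine ⟨fun i => Submodule.disjoint_def.2 fun x hx hx' => hq x fun y => ?_, h1⟩
  have h4 : ⨆ j, ⨆ (_ : j ≠ i), C j ≤ orthoSub q (C i) :=
    iSup₂_le fun j hj y hy z hz => h2 j i hj y hy z hz
  -- A vector of C_i that also lies in the sum of the others is orthogonal to every C_j, hence to L;
  -- nondegeneracy gives independence.
  have h5 : (⊤ : Submodule ℤ_[p] L) ≤ orthoSub q (Submodule.span ℤ_[p] {x}) := by
    rw [← h1]
    refine iSup_le fun j y hy z hz => ?_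
    obtain ⟨c, rfl⟩ := Submodule.mem_span_singleton.1 hz
    rw [QuadraticMap.polar_smul_right]
    by_cases hj : j = i
    · subst hj
      rw [QuadraticMap.polar_comm, h4 hx' y hy, smul_zero]
    · rw [h2 j i hj y hy x hx, smul_zero]
  rw [QuadraticMap.polar_comm]
  exact h5 (Submodule.mem_top (x := y)) x (Submodule.mem_span_singleton_self x)

end Jordan

end PadicLattice

namespace PadicLattice

/-! ### Extending isometries of a summand by the identity. -/

section Extension

variable {p : ℕ} [Fact p.Prime] {L : Type*} [AddCommGroup L] [Module ℤ_[p] L]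

theorem map_eq_of_polar_eq {q : QuadraticMap ℤ_[p] L ℚ_[p]} {x y : L}
    (h : QuadraticMap.polar q x x = QuadraticMap.polar q y y) : q x = q y := by
  rw [polar_self_eq, polar_self_eq] at h
  exact mul_left_cancel₀ two_ne_zero h

variable [Module.Free ℤ_[p] L] [Module.Finite ℤ_[p] L]

/-- From AᵀGA = G and det G ≠ 0 follows (det A)² = 1. Thus a form-preserving endomorphism is
automatically invertible, and surjectivity need not be checked. -/
theorem isUnit_det_of_polar_eq {q : QuadraticMap ℤ_[p] L ℚ_[p]} (hq : IsNondegenerate q)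
    {φ : L →ₗ[ℤ_[p]] L} (h : ∀ x y, QuadraticMap.polar q (φ x) (φ y) = QuadraticMap.polar q x y) :
    IsUnit (LinearMap.det φ) := by
  have h0 : ∀ k : ℤ, (p : ℚ_[p]) ^ k ≠ 0 := fun k => zpow_ne_zero _ p_ne_zero
  obtain ⟨k, hk⟩ := exists_polar_mem_fracIdeal q
  have v := Module.finBasis ℤ_[p] L
  choose G hG using fun i j => mem_fracIdeal.1 (hk (v i) (v j))
  have hdet : (Matrix.of G).det ≠ 0 := by
    intro h1
    obtain ⟨z, hz, hGz⟩ := Matrix.exists_vecMul_eq_zero_iff.2 h1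
    refine hz ?_
    have h2 : ∑ i, z i • v i = 0 := by
      refine hq _ fun y => ?_
      rw [← v.sum_repr y, polar_sum_right]
      refine Finset.sum_eq_zero fun j _ => ?_
      have h3 := congrFun hGz j
      rw [QuadraticMap.polar_smul_right, polar_sum_smul_left]
      have h4 : ∑ i, (z i : ℚ_[p]) * QuadraticMap.polar q (v i) (v j)
          = (Matrix.vecMul z (Matrix.of G) j : ℤ_[p]) * (p : ℚ_[p]) ^ k := by
        simp only [Matrix.vecMul, dotProduct, Matrix.of_apply, ← hG]
        rw [PadicInt.coe_sum, Finset.sum_mul]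
        refine Finset.sum_congr rfl fun i _ => ?_
        push_cast
        ring
      rw [h4, h3]
      simp
    funext i
    exact Fintype.linearIndependent_iff.1 v.linearIndependent z h2 i
  set A := LinearMap.toMatrix v v φ with hA
  have h1 : A.transpose * Matrix.of G * A = Matrix.of G := by
    ext i j
    refine mul_zpow_right_cancel (k := k) ?_
    have hφ : ∀ i, φ (v i) = ∑ l, A l i • v l := fun i => by
      conv_lhs => rw [← v.sum_repr (φ (v i))]
      exact Finset.sum_congr rfl fun l _ => by rw [hA, LinearMap.toMatrix_apply]
    rw [Matrix.of_apply, hG, ← h, hφ i, hφ j, polar_sum_right, Matrix.mul_apply, PadicInt.coe_sum,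
      Finset.sum_mul]
    refine Finset.sum_congr rfl fun l _ => ?_
    rw [QuadraticMap.polar_smul_right, polar_sum_smul_left, Matrix.mul_apply, coe_smul_eq_mul]
    push_cast
    rw [PadicInt.coe_sum, Finset.mul_sum, Finset.sum_mul, Finset.sum_mul]
    refine Finset.sum_congr rfl fun m _ => ?_
    rw [← hG, Matrix.transpose_apply, Matrix.of_apply]
    push_cast
    ring
  have h2 := congrArg Matrix.det h1
  rw [Matrix.det_mul, Matrix.det_mul, Matrix.det_transpose, mul_right_comm] at h2
  have h3 : A.det * A.det = 1 := mul_right_cancel₀ hdet (h2.trans (one_mul _).symm)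
  rw [← LinearMap.det_toMatrix v]
  exact IsUnit.of_mul_eq_one _ h3

/-- Extension of an isometric embedding of an orthogonal direct summand into itself by the
identity of its complement. -/
theorem exists_orthogonal_extension {q : QuadraticMap ℤ_[p] L ℚ_[p]} (hq : IsNondegenerate q)
    {W : Type*} [AddCommGroup W] [Module ℤ_[p] W] {e e' : W →ₗ[ℤ_[p]] L} {c : L →ₗ[ℤ_[p]] W}
    (hc : ∀ x u, QuadraticMap.polar q (x - e (c x)) (e u) = 0)
    (hrange : LinearMap.range e' ≤ LinearMap.range e)
    (he : ∀ u u', QuadraticMap.polar q (e' u) (e' u') = QuadraticMap.polar q (e u) (e u')) :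
    ∃ f : quadOrthogonalGroup q, ∀ x, (f : L ≃ₗ[ℤ_[p]] L) x = x - e (c x) + e' (c x) := by
  have horth : ∀ x u, QuadraticMap.polar q (x - e (c x)) (e' u) = 0 := by
    intro x u
    obtain ⟨u', hu'⟩ := hrange ⟨u, rfl⟩
    rw [← hu']
    exact hc x u'
  -- By `hc`, e ∘ c is the orthogonal projection to the range of e; φ keeps the complementary part
  -- and replaces e by e' on the projected part.
  set φ : L →ₗ[ℤ_[p]] L := LinearMap.id - e ∘ₗ c + e' ∘ₗ c with hφ
  have hφx : ∀ x, φ x = x - e (c x) + e' (c x) := fun x => rfl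
  have hpol : ∀ x y, QuadraticMap.polar q (φ x) (φ y) = QuadraticMap.polar q x y := by
    intro x y
    have hx : QuadraticMap.polar q x y
        = QuadraticMap.polar q (x - e (c x) + e (c x)) (y - e (c y) + e (c y)) := by
      rw [sub_add_cancel, sub_add_cancel]
    rw [hx, hφx, hφx]
    simp only [QuadraticMap.polar_add_left _ (x - e (c x)),
      QuadraticMap.polar_add_right _ _ (y - e (c y))]
    rw [horth, hc, QuadraticMap.polar_comm q (e' (c x)) (y - e (c y)), horth,
      QuadraticMap.polar_comm q (e (c x)) (y - e (c y)), hc, he]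
  refine ⟨⟨LinearEquiv.ofIsUnitDet (f := φ) (v := Module.finBasis ℤ_[p] L)
    (v' := Module.finBasis ℤ_[p] L) ?_, fun x => map_eq_of_polar_eq (hpol x x)⟩, fun x => hφx x⟩
  rw [LinearMap.det_toMatrix]
  exact isUnit_det_of_polar_eq hq hpol

end Extension

/-! ### Coordinates on a Jordan constituent. -/

section Frame

variable {p : ℕ} [Fact p.Prime] {L : Type*} [AddCommGroup L] [Module ℤ_[p] L]
  {q : QuadraticMap ℤ_[p] L ℚ_[p]}

namespace JordanDecomposition

variable (J : JordanDecomposition q)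

theorem exists_sum_eq (x : L) : ∃ (s : Finset ℤ) (f : ℤ → L),
    (∀ i, f i ∈ J.component i) ∧ ∑ i ∈ s, f i = x := by
  classical
  obtain ⟨d, hd⟩ := J.isInternal.surjective x
  refine ⟨d.support, fun i => (d i : L), fun i => (d i).2, ?_⟩
  rw [← hd]
  exact (DirectSum.coeLinearMap_eq_dfinsuppSum J.component d).symm

theorem component_le_scaledDual (i : ℤ) : J.component i ≤ scaledDual q i := by
  intro x hx
  refine mem_scaledDual.2 fun y => ?_
  obtain ⟨s, f, hf, rfl⟩ := J.exists_sum_eq y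
  rw [polar_sum_right]
  refine sum_mem fun j _ => ?_
  by_cases hji : j = i
  · subst hji
    have h1 := (J.unimodular j).polar_integral ⟨x, hx⟩ ⟨f j, hf j⟩
    rw [polar_rescale] at h1
    exact (zpow_mul_mem (-j) 0 (by ring)).1 h1
  · rw [J.orthogonal i j (Ne.symm hji) x hx _ (hf j)]
    exact zero_mem _

/-- Every class in `ρ_i(L)` has a representative in the `i`-th Jordan constituent. -/
theorem exists_component_sub_mem_filt {i : ℤ} {x : L} (hx : x ∈ scaledDual q i) :
    ∃ m ∈ J.component i, x - m ∈ filt q (i + 1) := by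
  classical
  obtain ⟨s, f, hf, rfl⟩ := J.exists_sum_eq x
  refine ⟨if i ∈ s then f i else 0, by split_ifs; exacts [hf i, zero_mem _], ?_⟩
  have h1 : ∑ j ∈ s, f j - (if i ∈ s then f i else 0) = ∑ j ∈ s.erase i, f j := by
    split_ifs with hi
    · rw [Finset.sum_erase_eq_sub hi]
    · rw [Finset.erase_eq_of_notMem hi, sub_zero]
  rw [h1]
  refine sum_mem fun j hj => ?_
  rw [Finset.mem_erase] at hj
  rcases lt_or_gt_of_ne hj.1 with hji | hji
  · obtain ⟨m, hm⟩ := Int.le.dest (Int.add_one_le_iff.2 hji)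
    have h2 : ∀ y : J.component j, QuadraticMap.polar (rescale q (J.component j) j)
        ⟨f j, hf j⟩ y ∈ fracIdeal p ((m + 1 : ℕ) : ℤ) := by
      intro y
      rw [polar_rescale]
      refine (zpow_mul_mem (-j) _ (k := i) (by push_cast; lia)).2 ?_
      have h3 := mem_scaledDual.1 hx (y : L)
      rw [QuadraticMap.polar_comm, polar_sum_right, Finset.sum_eq_single j
        (fun l _ hlj => J.orthogonal j l (Ne.symm hlj) _ y.2 _ (hf l))
        (fun h => absurd hj.2 h), QuadraticMap.polar_comm] at h3
      exact h3
    obtain ⟨z, hz⟩ := (J.unimodular j).exists_smul (m + 1) h2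
    have hz' : f j = (p : ℤ_[p]) ^ (m + 1) • (z : L) := congrArg Subtype.val hz
    refine mem_filt.2 ⟨0, zero_mem _, (p : ℤ_[p]) ^ m • (z : L), ?_⟩
    rw [hz', smul_smul, ← pow_succ', zero_add]
  · exact Submodule.mem_sup_left (scaledDual_anti q (Int.add_one_le_iff.2 hji)
      (J.component_le_scaledDual j (hf j)))

/-- Coordinates on a Jordan constituent. -/
theorem exists_frame (i : ℤ) : ∃ (n : ℕ) (S : Matrix (Fin n) (Fin n) ℤ_[p])
    (V : (Fin n → ℤ_[p]) →ₗ[ℤ_[p]] L) (c : L →ₗ[ℤ_[p]] (Fin n → ℤ_[p])),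
    S.transpose = S ∧ IsUnit S.det ∧ LinearMap.range V = J.component i ∧
    (∀ d, c (V d) = d) ∧
    ∀ x d, QuadraticMap.polar q x (V d)
      = (c x ⬝ᵥ S.mulVec d : ℤ_[p]) * (p : ℚ_[p]) ^ i := by
  have h0 : (p : ℚ_[p]) ^ i ≠ 0 := zpow_ne_zero _ p_ne_zero
  obtain ⟨n, v, S, hS, hSu⟩ := J.unimodular i
  have hvS : ∀ a b, QuadraticMap.polar q (v a : L) (v b) = S a b * (p : ℚ_[p]) ^ i := by
    intro a b
    have := hS a b
    rw [polar_rescale, zpow_neg] at this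
    rw [← this]
    field_simp
  choose β hβ using fun a => exists_linearMap_mul_zpow (QuadraticMap.polarBilin q (v a : L))
    (fun y => mem_scaledDual.1 (J.component_le_scaledDual i (v a).2) y)
  have hβ' : ∀ a x, QuadraticMap.polar q x (v a : L) = β a x * (p : ℚ_[p]) ^ i := fun a x => by
    rw [QuadraticMap.polar_comm]
    exact hβ a x
  set V : (Fin n → ℤ_[p]) →ₗ[ℤ_[p]] L := Fintype.linearCombination ℤ_[p] (fun a => (v a : L))
    with hV
  have hVd : ∀ d, V d = ∑ a, d a • (v a : L) := fun d => rfl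
  -- Coordinates of the orthogonal projection to L_i: the products p^(-i) b(x, v_a), multiplied by
  -- the inverse Gram matrix.
  set c : L →ₗ[ℤ_[p]] (Fin n → ℤ_[p]) := (Matrix.vecMulLinear S⁻¹) ∘ₗ LinearMap.pi β with hc
  have hcx : ∀ x, c x = Matrix.vecMul (fun a => β a x) S⁻¹ := fun x => rfl
  have hST : S.transpose = S := by
    ext a b
    refine mul_zpow_right_cancel (k := i) ?_
    rw [Matrix.transpose_apply, ← hvS, ← hvS, QuadraticMap.polar_comm]
  refine ⟨n, S, V, c, hST, hSu, ?_, fun d => ?_, fun x d => ?_⟩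
  · refine le_antisymm ?_ fun x hx => ⟨v.repr ⟨x, hx⟩, ?_⟩
    · rintro _ ⟨d, rfl⟩
      rw [hVd]
      exact sum_mem fun a _ => Submodule.smul_mem _ _ (v a).2
    · rw [hVd]
      have := congrArg Subtype.val (v.sum_repr ⟨x, hx⟩)
      simpa only [Submodule.coe_sum, Submodule.coe_smul] using this
  · have h1 : (fun a => β a (V d)) = Matrix.vecMul d S := by
      funext a
      refine mul_zpow_right_cancel (k := i) ?_
      rw [← hβ', hVd, polar_sum_smul_left, Matrix.vecMul, dotProduct, PadicInt.coe_sum,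
        Finset.sum_mul]
      refine Finset.sum_congr rfl fun b _ => ?_
      rw [hvS]
      push_cast
      ring
    rw [hcx, h1, Matrix.vecMul_vecMul, Matrix.mul_nonsing_inv _ hSu, Matrix.vecMul_one]
  · rw [hcx, ← Matrix.dotProduct_mulVec, Matrix.mulVec_mulVec, Matrix.nonsing_inv_mul _ hSu,
      Matrix.one_mulVec, hVd, polar_sum_right, dotProduct, PadicInt.coe_sum, Finset.sum_mul]
    refine Finset.sum_congr rfl fun a _ => ?_
    rw [QuadraticMap.polar_smul_right, hβ', coe_smul_eq_mul]
    push_cast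
    ring

/-- Some b(y, y) p^(-j) is an integer not divisible by 2. Hence 2 is not a unit, so p = 2, and that
integer is a unit. -/
theorem exists_isUnit_of_not_isEven {j : ℤ} (h : ¬ IsEven (J.form j)) :
    p = 2 ∧ ∃ y ∈ J.component j, ∃ e : ℤ_[p], IsUnit e ∧
      QuadraticMap.polar q y y = e * (p : ℚ_[p]) ^ j := by
  unfold IsEven at h
  push Not at h
  obtain ⟨⟨y, hy⟩, hc⟩ := h
  obtain ⟨e, he⟩ := mem_fracIdeal.1 (mem_scaledDual.1 (J.component_le_scaledDual j hy) y)
  have h0 : (p : ℚ_[p]) ^ j ≠ 0 := zpow_ne_zero _ p_ne_zero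
  have h1 : ¬ 2 ∣ e := by
    rintro ⟨d, rfl⟩
    refine hc d ?_
    change QuadraticMap.polar (rescale q (J.component j) j) _ _ = _
    rw [polar_rescale, ← he, zpow_neg]
    have e2 : ((2 : ℤ_[p]) : ℚ_[p]) = 2 := rfl
    rw [PadicInt.coe_mul, e2]
    field_simp
  rcases two_dvd_p_or_isUnit (p := p) with ⟨-, rfl⟩ | h2
  · exact ⟨rfl, y, hy, e, isUnit_of_not_two_dvd h1, he.symm⟩
  · exact absurd h2.dvd h1

end JordanDecomposition

end Frame

end PadicLattice

namespace PadicLattice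

open Matrix

/-! ### Isometries of L built from matrices on one constituent. -/

section Isometries

variable {p : ℕ} [Fact p.Prime] {L : Type*} [AddCommGroup L] [Module ℤ_[p] L]
  {q : QuadraticMap ℤ_[p] L ℚ_[p]} {n : ℕ} {S : Matrix (Fin n) (Fin n) ℤ_[p]}
  {V : (Fin n → ℤ_[p]) →ₗ[ℤ_[p]] L} {c : L →ₗ[ℤ_[p]] (Fin n → ℤ_[p])} {i : ℤ}

theorem coordinates_eq_zero (hSu : IsUnit S.det)
    (hc : ∀ x d, QuadraticMap.polar q x (V d) = (c x ⬝ᵥ S *ᵥ d : ℤ_[p]) * (p : ℚ_[p]) ^ i)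
    {x : L} (hx : ∀ d, QuadraticMap.polar q x (V d) = 0) : c x = 0 := by
  funext a
  have h1 := hc x (S⁻¹ *ᵥ Pi.single a 1)
  rw [hx, mulVec_mulVec, mul_nonsing_inv _ hSu, one_mulVec, dotProduct_single, mul_one] at h1
  refine mul_zpow_right_cancel (k := i) ?_
  rw [← h1]
  simp

theorem dotProduct_mulVec_conj {R : Type*} [CommRing R] (S g : Matrix (Fin n) (Fin n) R)
    (d d' : Fin n → R) : (g *ᵥ d) ⬝ᵥ S *ᵥ (g *ᵥ d') = d ⬝ᵥ (gᵀ * S * g) *ᵥ d' := by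
  rw [Matrix.mul_assoc, ← mulVec_mulVec, ← mulVec_mulVec, dotProduct_mulVec d, vecMul_transpose]

theorem polar_frame (hcV : ∀ d, c (V d) = d)
    (hc : ∀ x d, QuadraticMap.polar q x (V d) = (c x ⬝ᵥ S *ᵥ d : ℤ_[p]) * (p : ℚ_[p]) ^ i)
    (d d' : Fin n → ℤ_[p]) :
    QuadraticMap.polar q (V d) (V d') = (d ⬝ᵥ S *ᵥ d' : ℤ_[p]) * (p : ℚ_[p]) ^ i := by
  rw [hc, hcV]

variable [Module.Free ℤ_[p] L] [Module.Finite ℤ_[p] L]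

/-- An isometry of a Jordan constituent extends to the lattice. -/
theorem exists_isometry_of_frame (hq : IsNondegenerate q) (hSu : IsUnit S.det)
    (hcV : ∀ d, c (V d) = d)
    (hc : ∀ x d, QuadraticMap.polar q x (V d) = (c x ⬝ᵥ S *ᵥ d : ℤ_[p]) * (p : ℚ_[p]) ^ i)
    {g : Matrix (Fin n) (Fin n) ℤ_[p]} (hg : gᵀ * S * g = S) :
    ∃ F : quadOrthogonalGroup q, (∀ d, (F : L ≃ₗ[ℤ_[p]] L) (V d) = V (g *ᵥ d)) ∧
      ∀ y, (∀ d, QuadraticMap.polar q y (V d) = 0) → (F : L ≃ₗ[ℤ_[p]] L) y = y := by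
  obtain ⟨F, hF⟩ := exists_orthogonal_extension hq (e := V) (e' := V ∘ₗ g.mulVecLin) (c := c)
    (fun x u => by
      rw [QuadraticMap.polar_sub_left, hc, hc, hcV, sub_self])
    (LinearMap.range_comp_le_range _ _)
    (fun u u' => by
      simp only [LinearMap.comp_apply, mulVecLin_apply]
      rw [polar_frame hcV hc, polar_frame hcV hc, dotProduct_mulVec_conj, hg])
  refine ⟨F, fun d => ?_, fun y hy => ?_⟩
  · rw [hF, hcV, sub_self, zero_add]
    rfl
  · rw [hF, coordinates_eq_zero hSu hc hy, map_zero, map_zero, sub_zero, add_zero]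

/-- Matrix determinant lemma, after factoring out S. It identifies the norm of the vector
complementary to the embedded constituent as a square multiple of the norm of f. -/
theorem det_sub_smul_vecMulVec {R : Type*} [CommRing R] (S : Matrix (Fin n) (Fin n) R) (k : R)
    (a b : Fin n → R) :
    (S - k • vecMulVec (S *ᵥ a) b).det = S.det * (1 - k * (b ⬝ᵥ a)) := by
  have h1 : S - k • vecMulVec (S *ᵥ a) b
      = S * (1 + replicateCol Unit (-(k • a)) * replicateRow Unit b) := by
    rw [← vecMulVec_eq, Matrix.mul_add, Matrix.mul_one, mul_vecMulVec, mulVec_neg, mulVec_smul,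
      neg_vecMulVec, smul_vecMulVec, sub_eq_add_neg]
  rw [h1, det_mul, det_one_add_replicateCol_mul_replicateRow, dotProduct_neg, dotProduct_smul,
    smul_eq_mul, sub_eq_add_neg]

/-- An embedding of a Jordan constituent into its sum with a line of a neighbouring constituent
extends to the lattice. -/
theorem exists_isometry_of_frame_sup_line (hq : IsNondegenerate q)
    (hSu : IsUnit S.det) (hcV : ∀ d, c (V d) = d)
    (hc : ∀ x d, QuadraticMap.polar q x (V d) = (c x ⬝ᵥ S *ᵥ d : ℤ_[p]) * (p : ℚ_[p]) ^ i)
    {j : ℤ} {f : L} (hf : f ∈ scaledDual q j) {ε : ℤ_[p]} (hε : IsUnit ε)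
    (hff : QuadraticMap.polar q f f = ε * (p : ℚ_[p]) ^ j)
    (hfV : ∀ d, QuadraticMap.polar q f (V d) = 0)
    {s t : ℤ_[p]} (hst : s * t = 2) (hsj : (s : ℚ_[p]) * (p : ℚ_[p]) ^ j = t * (p : ℚ_[p]) ^ i)
    {g : Matrix (Fin n) (Fin n) ℤ_[p]} {α : Fin n → ℤ_[p]}
    (hg : gᵀ * S * g = S - (2 * ε) • vecMulVec α α) {r : ℤ_[p]} (hr : r * g.det = 1) :
    ∃ F : quadOrthogonalGroup q,
      (∀ d, (F : L ≃ₗ[ℤ_[p]] L) (V d) = V (g *ᵥ d) + (α ⬝ᵥ d) • s • f) ∧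
      ∀ y, (∀ d, QuadraticMap.polar q y (V d) = 0) →
        (QuadraticMap.polar q y f = 0 → (F : L ≃ₗ[ℤ_[p]] L) y = y) ∧
        ∃ (k l : ℤ_[p]) (d : Fin n → ℤ_[p]),
          (F : L ≃ₗ[ℤ_[p]] L) y - y = k • (r - 1) • f + t • (V d + l • s • f) := by
  obtain ⟨η, hη⟩ := hε.exists_left_inv
  obtain ⟨φ, hφ⟩ := exists_linearMap_mul_zpow (QuadraticMap.polarBilin q f)
    (fun y => mem_scaledDual.1 hf y)
  have hφ' : ∀ y, QuadraticMap.polar q y f = φ y * (p : ℚ_[p]) ^ j := fun y => by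
    rw [QuadraticMap.polar_comm]
    exact hφ y
  have hφV : ∀ d, φ (V d) = 0 := fun d => mul_zpow_right_cancel (k := j) (by
    rw [← hφ', QuadraticMap.polar_comm, hfV]
    simp)
  set a := S⁻¹ *ᵥ α with ha
  have hSa : S *ᵥ a = α := by rw [ha, mulVec_mulVec, mul_nonsing_inv _ hSu, one_mulVec]
  clear_value a
  -- Comparison of determinants in gᵀSg = S - 2ε ααᵀ, where α = Sa.
  have hdet : 1 - 2 * ε * (α ⬝ᵥ a) = g.det * g.det := by
    have h1 := congrArg Matrix.det hg
    have h2 := det_sub_smul_vecMulVec S (2 * ε) a α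
    rw [hSa, ← h1, det_mul, det_mul, det_transpose] at h2
    refine hSu.mul_left_cancel ?_
    rw [← h2]
    ring
  set ψ : (Fin n → ℤ_[p]) →ₗ[ℤ_[p]] L := V ∘ₗ g.mulVecLin
    + (LinearMap.toSpanSingleton ℤ_[p] L (s • f)) ∘ₗ (dotProductBilin ℤ_[p] ℤ_[p] α) with hψ
  have hψd : ∀ d, ψ d = V (g *ᵥ d) + (α ⬝ᵥ d) • s • f := fun d => rfl
  have hVf : ∀ d, QuadraticMap.polar q (V d) f = 0 := fun d => by
    rw [QuadraticMap.polar_comm, hfV]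
  -- This normalisation of s makes the f-component of ψ contribute 2ε(α·d)(α·d') p^i, exactly what
  -- gᵀSg lacks.
  have hs2 : (s : ℚ_[p]) * s * (p : ℚ_[p]) ^ j = 2 * (p : ℚ_[p]) ^ i := by
    have : (s : ℚ_[p]) * t = 2 := by
      rw [← PadicInt.coe_mul, hst]
      rfl
    rw [mul_assoc, hsj, ← mul_assoc, this]
  have e2 : ((2 : ℤ_[p]) : ℚ_[p]) = 2 := rfl
  have hψψ : ∀ d d', QuadraticMap.polar q (ψ d) (ψ d')
      = (d ⬝ᵥ S *ᵥ d' : ℤ_[p]) * (p : ℚ_[p]) ^ i := by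
    intro d d'
    have h1 : d ⬝ᵥ (gᵀ * S * g) *ᵥ d' = d ⬝ᵥ S *ᵥ d' - 2 * ε * ((α ⬝ᵥ d) * (α ⬝ᵥ d')) := by
      rw [hg, sub_mulVec, dotProduct_sub, smul_mulVec, dotProduct_smul, vecMulVec_mulVec,
        dotProduct_smul, dotProduct_comm d α, smul_eq_mul]
      simp only [MulOpposite.smul_eq_mul_unop, MulOpposite.unop_op]
    rw [hψd, hψd, QuadraticMap.polar_add_left, QuadraticMap.polar_add_right,
      QuadraticMap.polar_add_right, polar_frame hcV hc, dotProduct_mulVec_conj, h1]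
    simp only [QuadraticMap.polar_smul_left, QuadraticMap.polar_smul_right, hVf, hfV, hff,
      coe_smul_eq_mul]
    push_cast
    rw [e2]
    linear_combination (ε : ℚ_[p]) * (α ⬝ᵥ d : ℤ_[p]) * (α ⬝ᵥ d' : ℤ_[p]) * hs2
  have hψf : ∀ d, QuadraticMap.polar q (ψ d) f
      = (α ⬝ᵥ d : ℤ_[p]) * s * ε * (p : ℚ_[p]) ^ j := by
    intro d
    rw [hψd, QuadraticMap.polar_add_left, hVf, QuadraticMap.polar_smul_left,
      QuadraticMap.polar_smul_left, hff]
    simp only [coe_smul_eq_mul]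
    ring
  -- The bracket is f minus its projection to the image of ψ. Its norm is ε p^j (1 - 2ε α·a) = ε p^j
  -- (det g)², so r = 1 / det g restores the norm of f.
  set f' := r • (f - (t * ε) • ψ a) with hf'
  have hψf' : ∀ d, QuadraticMap.polar q (ψ d) f' = 0 := by
    intro d
    rw [hf', QuadraticMap.polar_smul_right, QuadraticMap.polar_sub_right,
      QuadraticMap.polar_smul_right, hψf, hψψ, hSa, dotProduct_comm d α]
    simp only [coe_smul_eq_mul]
    push_cast
    linear_combination (r : ℚ_[p]) * (α ⬝ᵥ d : ℤ_[p]) * ε * hsj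
  have hf'f' : QuadraticMap.polar q f' f' = QuadraticMap.polar q f f := by
    have h1 : QuadraticMap.polar q f' f' = r • QuadraticMap.polar q f f' := by
      conv_lhs => rw [hf', QuadraticMap.polar_smul_left, QuadraticMap.polar_sub_left,
        QuadraticMap.polar_smul_left, ← hf', hψf']
      rw [smul_zero, sub_zero]
    have h2 : ((r * r * (1 - 2 * ε * (α ⬝ᵥ a)) : ℤ_[p]) : ℚ_[p]) = 1 := by
      rw [hdet]
      have : r * r * (g.det * g.det) = (r * g.det) * (r * g.det) := by ring
      rw [this, hr]
      simp
    push_cast at h2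
    rw [e2] at h2
    have hst' : (s : ℚ_[p]) * t = 2 := by
      rw [← PadicInt.coe_mul, hst]
      rfl
    rw [h1, hf', QuadraticMap.polar_smul_right, QuadraticMap.polar_sub_right,
      QuadraticMap.polar_smul_right, QuadraticMap.polar_comm q f (ψ a), hψf, hff]
    simp only [coe_smul_eq_mul]
    push_cast
    linear_combination (ε : ℚ_[p]) * (p : ℚ_[p]) ^ j * h2
      - (r : ℚ_[p]) * r * ε * ε * (α ⬝ᵥ a : ℤ_[p]) * (p : ℚ_[p]) ^ j * hst'
  set e : (Fin n → ℤ_[p]) × ℤ_[p] →ₗ[ℤ_[p]] L :=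
    V.coprod (LinearMap.toSpanSingleton ℤ_[p] L f) with he
  have hed : ∀ d k, e (d, k) = V d + k • f := fun d k => rfl
  set e' : (Fin n → ℤ_[p]) × ℤ_[p] →ₗ[ℤ_[p]] L :=
    ψ.coprod (LinearMap.toSpanSingleton ℤ_[p] L f') with he'
  have hed' : ∀ d k, e' (d, k) = ψ d + k • f' := fun d k => rfl
  have hVrange : ∀ d, V d ∈ LinearMap.range e := fun d =>
    ⟨(d, 0), by rw [hed, zero_smul, add_zero]⟩
  have hfrange : f ∈ LinearMap.range e := ⟨(0, 1), by rw [hed, map_zero, one_smul, zero_add]⟩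
  have hψrange : ∀ d, ψ d ∈ LinearMap.range e := fun d => by
    rw [hψd]
    exact add_mem (hVrange _) (Submodule.smul_mem _ _ (Submodule.smul_mem _ _ hfrange))
  -- The coordinate of y along f is η φ(y), where η inverts ε. For y orthogonal to L_i this gives Fy
  -- - y = η φ(y) (f' - f).
  obtain ⟨F, hF⟩ := exists_orthogonal_extension hq (e := e) (e' := e') (c := c.prod (η • φ))
    (fun x u => by
      obtain ⟨d, k⟩ := u
      have h1 : e (c.prod (η • φ) x) = V (c x) + (η * φ x) • f := rfl
      have h2 : QuadraticMap.polar q (V (c x)) (V d) = QuadraticMap.polar q x (V d) := by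
        rw [hc, hc, hcV]
      have h3 : (η : ℚ_[p]) * ε = 1 := by
        rw [← PadicInt.coe_mul, hη]
        rfl
      rw [h1, hed, QuadraticMap.polar_sub_left, QuadraticMap.polar_add_left,
        QuadraticMap.polar_add_right, QuadraticMap.polar_add_right, QuadraticMap.polar_add_right,
        h2]
      simp only [QuadraticMap.polar_smul_left, QuadraticMap.polar_smul_right, hVf, hfV, hff,
        coe_smul_eq_mul]
      rw [hφ' x]
      push_cast
      linear_combination -(k : ℚ_[p]) * φ x * (p : ℚ_[p]) ^ j * h3)
    (by
      rintro _ ⟨⟨d, k⟩, rfl⟩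
      rw [hed', hf']
      exact add_mem (hψrange _) (Submodule.smul_mem _ _ (Submodule.smul_mem _ _
        (sub_mem hfrange (Submodule.smul_mem _ _ (hψrange _))))))
    (fun u u' => by
      obtain ⟨d, k⟩ := u
      obtain ⟨d', k'⟩ := u'
      rw [hed, hed, hed', hed']
      simp only [QuadraticMap.polar_add_left, QuadraticMap.polar_add_right,
        QuadraticMap.polar_smul_left, QuadraticMap.polar_smul_right]
      rw [hψψ, hψf', QuadraticMap.polar_comm q f' (ψ d'), hψf', hf'f', hVf, hfV,
        polar_frame hcV hc])
  have hF' : ∀ y, (F : L ≃ₗ[ℤ_[p]] L) y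
      = y - (V (c y) + (η * φ y) • f) + (ψ (c y) + (η * φ y) • f') := hF
  refine ⟨F, fun d => ?_, fun y hy => ?_⟩
  · rw [hF', hcV, hφV, mul_zero, zero_smul, zero_smul, add_zero, add_zero, sub_self, zero_add,
      hψd]
  · have hy0 := coordinates_eq_zero hSu hc hy
    refine ⟨fun hyf => ?_, η * φ y, η * φ y * r * -ε * (α ⬝ᵥ a),
      (η * φ y * r * -ε) • (g *ᵥ a), ?_⟩
    · have h1 : φ y = 0 := mul_zpow_right_cancel (k := j) (by
        rw [← hφ', hyf]
        simp)
      rw [hF', hy0, h1]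
      simp
    · rw [hF', hy0, map_zero, map_zero, map_smul, hf', hψd]
      module

end Isometries

end PadicLattice

namespace PadicLattice

open Matrix

/-! ### From automorphisms of ρ_i(L) to isometries of L. -/

section Surjectivity

variable {p : ℕ} [Fact p.Prime] {L : Type*} [AddCommGroup L] [Module ℤ_[p] L]
  {q : QuadraticMap ℤ_[p] L ℚ_[p]}

theorem sub_mem_of_valueMk_eq {i : ℤ} {a b : ℚ_[p]} (h : valueMk i a = valueMk i b) :
    a - b ∈ fracIdeal p (i + 1) := by
  have h1 := (Submodule.Quotient.eq _).1 h
  change (p : ℚ_[p]) ^ (-i) * a - (p : ℚ_[p]) ^ (-i) * b ∈ _ at h1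
  rw [← mul_sub] at h1
  exact (zpow_mul_mem (-i) 1 (by ring)).1 h1

theorem p_smul_mem_filt (i : ℤ) (x : L) : (p : ℤ_[p]) • x ∈ filt q i :=
  mem_filt.2 ⟨0, zero_mem _, x, zero_add _⟩

theorem smul_mem_filt_of_dvd {i : ℤ} {k : ℤ_[p]} (h : (p : ℤ_[p]) ∣ k) (x : L) :
    k • x ∈ filt q i := by
  obtain ⟨l, rfl⟩ := h
  rw [mul_smul]
  exact p_smul_mem_filt i _

/-- The automorphism of `ρ_i(L)` induced by an isometry is determined by the values of the
isometry on the `i`-th Jordan constituent. -/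
theorem JordanDecomposition.rhoEquiv_eq (J : JordanDecomposition q) {i : ℤ}
    {F : quadOrthogonalGroup q} {σ : rho q i ≃ₗ[ℤ_[p]] rho q i}
    (h : ∀ x : scaledDual q i, (x : L) ∈ J.component i → σ (toRho q i x)
      = toRho q i ⟨(F : L ≃ₗ[ℤ_[p]] L) x, map_mem_scaledDual F i x.2⟩) :
    rhoEquiv q i F = σ := by
  refine LinearEquiv.ext fun x => ?_
  obtain ⟨⟨x, hx⟩, rfl⟩ := toRho_surjective q i x
  obtain ⟨m, hm, hxm⟩ := J.exists_component_sub_mem_filt hx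
  have h1 : toRho q i ⟨x, hx⟩ = toRho q i ⟨m, J.component_le_scaledDual i hm⟩ :=
    toRho_eq_iff.2 hxm
  rw [h1, h _ hm]
  rfl

theorem JordanDecomposition.rhoEquiv_eq_one (J : JordanDecomposition q) {i : ℤ}
    {F : quadOrthogonalGroup q}
    (h : ∀ x ∈ J.component i, (F : L ≃ₗ[ℤ_[p]] L) x - x ∈ filt q (i + 1)) :
    rhoEquiv q i F = 1 := by
  refine J.rhoEquiv_eq fun x hx => ?_
  exact (toRho_eq_iff.2 (h x hx)).symm

/-- An automorphism of `ρ_i(L)` is given by a matrix, with respect to coordinates on the `i`-th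
Jordan constituent. -/
theorem JordanDecomposition.exists_matrix (J : JordanDecomposition q) {i : ℤ} {n : ℕ}
    {V : (Fin n → ℤ_[p]) →ₗ[ℤ_[p]] L} (hV : LinearMap.range V = J.component i)
    (hVd : ∀ d, V d ∈ scaledDual q i) (σ : rho q i ≃ₗ[ℤ_[p]] rho q i) :
    ∃ g : Matrix (Fin n) (Fin n) ℤ_[p], ∀ d,
      σ (toRho q i ⟨V d, hVd d⟩) = toRho q i ⟨V (g *ᵥ d), hVd _⟩ := by
  have h1 : ∀ x : rho q i, ∃ d, toRho q i ⟨V d, hVd d⟩ = x := by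
    intro x
    obtain ⟨⟨x, hx⟩, rfl⟩ := toRho_surjective q i x
    obtain ⟨m, hm, hxm⟩ := J.exists_component_sub_mem_filt hx
    rw [← hV] at hm
    obtain ⟨d, rfl⟩ := hm
    exact ⟨d, (toRho_eq_iff.2 hxm).symm⟩
  choose G hG using fun a => h1 (σ (toRho q i ⟨V (Pi.single a 1), hVd _⟩))
  refine ⟨Matrix.of fun b a => G a b, fun d => ?_⟩
  have h2 : σ.toLinearMap ∘ₗ toRho q i ∘ₗ V.codRestrict _ hVd
      = toRho q i ∘ₗ V.codRestrict _ hVd ∘ₗ (Matrix.of fun b a => G a b).mulVecLin := by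
    refine (Pi.basisFun ℤ_[p] (Fin n)).ext fun a => ?_
    rw [Pi.basisFun_apply]
    refine (hG a).symm.trans ?_
    have h3 : (Matrix.of fun b a => G a b) *ᵥ Pi.single a 1 = G a := by
      rw [mulVec_single_one]
      rfl
    conv_lhs => rw [← h3]
    rfl
  exact LinearMap.congr_fun h2 d

/-- In the free case b̄_i is preserved as the polarisation of q̄_i, so the congruence gᵀSg ≡ S mod p
is available in both cases. -/
theorem sub_mem_of_mem_rhoOrthogonalGroup {i : ℤ} {σ : rho q i ≃ₗ[ℤ_[p]] rho q i}
    (hσ : σ ∈ rhoOrthogonalGroup q i) {x y x' y' : scaledDual q i}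
    (hx : σ (toRho q i x) = toRho q i x') (hy : σ (toRho q i y) = toRho q i y') :
    QuadraticMap.polar q (x' : L) (y' : L) - QuadraticMap.polar q (x : L) (y : L)
      ∈ fracIdeal p (i + 1) := by
  refine sub_mem_of_valueMk_eq ?_
  unfold rhoOrthogonalGroup at hσ
  split_ifs at hσ with h
  · have hσ' : ∀ z z' : scaledDual q i, σ (toRho q i z) = toRho q i z' →
        valueMk i (q (z' : L)) = valueMk i (q (z : L)) := by
      intro z z' hz
      have h1 : qbar q i h (σ (toRho q i z)) = qbar q i h (toRho q i z) := hσ _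
      rwa [hz, qbar_toRho, qbar_toRho] at h1
    have h1 := hσ' (x + y) (x' + y') (by rw [map_add, map_add, hx, hy, map_add])
    have h2 := hσ' x x' hx
    have h3 := hσ' y y' hy
    rw [QuadraticMap.polar, QuadraticMap.polar, map_sub, map_sub, map_sub, map_sub, h2, h3]
    exact congrArg (fun z => z - _ - _) h1
  · have h1 : bbar q i (σ (toRho q i x)) (σ (toRho q i y)) = bbar q i (toRho q i x) (toRho q i y) :=
      hσ _ _
    rwa [hx, hy, bbar_toRho, bbar_toRho] at h1

theorem map_sub_mem_of_mem_rhoOrthogonalGroup {i : ℤ} (h : IsFree q i)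
    {σ : rho q i ≃ₗ[ℤ_[p]] rho q i} (hσ : σ ∈ rhoOrthogonalGroup q i) {x x' : scaledDual q i}
    (hx : σ (toRho q i x) = toRho q i x') : q x' - q x ∈ fracIdeal p (i + 1) := by
  refine sub_mem_of_valueMk_eq ?_
  rw [rhoOrthogonalGroup, dif_pos h] at hσ
  have h1 : qbar q i h (σ (toRho q i x)) = qbar q i h (toRho q i x) := hσ _
  rwa [hx, qbar_toRho, qbar_toRho] at h1

theorem isUnit_det_of_dvd_sub {n : ℕ} {S g : Matrix (Fin n) (Fin n) ℤ_[p]} (hSu : IsUnit S.det)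
    (h : ∀ a b, (p : ℤ_[p]) ∣ (S - gᵀ * S * g) a b) : IsUnit g.det := by
  have h1 : ∀ a b, (p : ℤ_[p]) ∣ (gᵀ * S * g) a b - S a b := fun a b => by
    rw [← neg_sub, dvd_neg]
    exact h a b
  have h2 := isUnit_of_p_dvd_sub (p_dvd_det_sub h1) hSu
  rw [det_mul] at h2
  exact isUnit_of_mul_isUnit_right h2

theorem apply_sub_mem_filt {n : ℕ} (V : (Fin n → ℤ_[p]) →ₗ[ℤ_[p]] L)
    {g g' : Matrix (Fin n) (Fin n) ℤ_[p]} (h : ∀ a b, (p : ℤ_[p]) ∣ g' a b - g a b) (i : ℤ)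
    (d : Fin n → ℤ_[p]) : V (g' *ᵥ d) - V (g *ᵥ d) ∈ filt q i := by
  choose k hk using h
  have h1 : g' *ᵥ d - g *ᵥ d = (p : ℤ_[p]) • (Matrix.of k *ᵥ d) := by
    rw [← sub_mulVec, ← smul_mulVec]
    congr 1
    ext a b
    exact hk a b
  rw [← map_sub, h1, map_smul]
  exact p_smul_mem_filt i _

/-- The quadratic form of a matrix divisible by `2` is, modulo `2`, the square of a linear form. -/
theorem exists_formDvd_sub_smul_vecMulVec {n : ℕ} {D : Matrix (Fin n) (Fin n) ℤ_[2]}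
    (h : ∀ a b, 2 ∣ D a b) {e : ℤ_[2]} (he : IsUnit e) :
    ∃ α : Fin n → ℤ_[2], FormDvd 2 (D - (2 * e) • vecMulVec α α) := by
  -- Modulo 2 the halved form is ∑ (D_aa / 2) x_a², the square of ∑ (D_aa / 2) x_a; the unit e is
  -- congruent to 1 and does no harm.
  choose α hα using fun a => h a a
  refine ⟨α, fun a b => ?_, fun a => ?_⟩
  · rw [Matrix.sub_apply, Matrix.smul_apply, smul_eq_mul, mul_assoc]
    exact dvd_sub (h a b) (dvd_mul_right _ _)
  · have h1 : 2 ∣ e - 1 := by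
      have := two_dvd_sq_sub_self e
      have h2 : e * e - e = e * (e - 1) := by ring
      rwa [h2, he.dvd_mul_left] at this
    have h3 : (D - (2 * e) • vecMulVec α α) a a
        = 2 * (-(α a * α a - α a) - (e - 1) * (α a * α a)) := by
      rw [Matrix.sub_apply, Matrix.smul_apply, smul_eq_mul, hα, vecMulVec_apply]
      ring
    rw [h3]
    exact mul_dvd_mul_left 2
      (dvd_sub (dvd_neg.2 (two_dvd_sq_sub_self _)) (Dvd.dvd.mul_right h1 _))

variable [Module.Free ℤ_[p] L] [Module.Finite ℤ_[p] L]

/-- The heart of the proof: each factor O(ρ_i(L)) is hit separately, by an isometry that is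
invisible in every other factor. -/
theorem JordanDecomposition.exists_rhoEquiv_eq (J : JordanDecomposition q)
    (hq : IsNondegenerate q) {i : ℤ} {σ : rho q i ≃ₗ[ℤ_[p]] rho q i}
    (hσ : σ ∈ rhoOrthogonalGroup q i) :
    ∃ F : quadOrthogonalGroup q, rhoEquiv q i F = σ ∧ ∀ l, l ≠ i → rhoEquiv q l F = 1 := by
  obtain ⟨n, S, V, c, hS, hSu, hV, hcV, hc⟩ := J.exists_frame i
  have hVc : ∀ d, V d ∈ J.component i := fun d => hV ▸ ⟨d, rfl⟩
  have hVd : ∀ d, V d ∈ scaledDual q i := fun d => J.component_le_scaledDual i (hVc d)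
  have hVV := polar_frame hcV hc
  have horth : ∀ l, l ≠ i → ∀ y ∈ J.component l, ∀ d, QuadraticMap.polar q y (V d) = 0 :=
    fun l hl y hy d => J.orthogonal l i hl y hy _ (hVc d)
  obtain ⟨g, hg⟩ := J.exists_matrix hV hVd σ
  have hD : ∀ a b, (p : ℤ_[p]) ∣ (S - gᵀ * S * g) a b := by
    intro a b
    have h1 := sub_mem_of_mem_rhoOrthogonalGroup hσ (hg (Pi.single a 1)) (hg (Pi.single b 1))
    rw [hVV, hVV, dotProduct_mulVec_conj] at h1
    simp only [single_one_dotProduct, mulVec_single_one, col_apply] at h1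
    refine dvd_of_mul_zpow_mem (k := i) ?_
    rw [← neg_mem_iff]
    convert h1 using 1
    rw [Matrix.sub_apply, PadicInt.coe_sub]
    ring
  have hgu := isUnit_det_of_dvd_sub hSu hD
  have hσF : ∀ F : quadOrthogonalGroup q,
      (∀ d, V (g *ᵥ d) - (F : L ≃ₗ[ℤ_[p]] L) (V d) ∈ filt q (i + 1)) → rhoEquiv q i F = σ := by
    intro F hF
    refine J.rhoEquiv_eq fun ⟨x, hx⟩ hxJ => ?_
    rw [← hV] at hxJ
    obtain ⟨d, rfl⟩ := hxJ
    rw [hg, toRho_eq_iff]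
    exact hF d
  by_cases hfree : IsFree q i
  -- Diagonal entries are twice values of p^(-i) q, and q̄_i is preserved modulo p; hence the extra
  -- factor 2. Taking α = 0 asks for a genuine isometry of S.
  · have hD2 : FormDvd (p : ℤ_[p]) (S - (2 * 1 : ℤ_[p]) • vecMulVec (0 : Fin n → ℤ_[p]) 0
        - gᵀ * S * g) := by
      rw [zero_vecMulVec, smul_zero, sub_zero]
      refine ⟨hD, fun a => ?_⟩
      have h1 := map_sub_mem_of_mem_rhoOrthogonalGroup hfree hσ (hg (Pi.single a 1))
      obtain ⟨k, hk⟩ := mem_fracIdeal.1 h1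
      have h2 := hVV (Pi.single a 1) (Pi.single a 1)
      have h3 := hVV (g *ᵥ Pi.single a 1) (g *ᵥ Pi.single a 1)
      rw [polar_self_eq] at h2 h3
      rw [dotProduct_mulVec_conj] at h3
      simp only [single_one_dotProduct, mulVec_single_one, col_apply] at h2 h3 hk
      refine ⟨-k, mul_zpow_right_cancel (k := i) ?_⟩
      rw [Matrix.sub_apply, PadicInt.coe_sub, sub_mul, ← h2, ← h3]
      have e2 : ((2 : ℤ_[p]) : ℚ_[p]) = 2 := rfl
      push_cast
      rw [e2]
      rw [zpow_add₀ p_ne_zero, zpow_one] at hk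
      linear_combination 2 * hk
    obtain ⟨g', hg', hS'⟩ := exists_lift_isometry hS hSu hgu isUnit_one hD2
    rw [zero_vecMulVec, smul_zero, sub_zero] at hS'
    obtain ⟨F, hF1, hF2⟩ := exists_isometry_of_frame hq hSu hcV hc hS'
    refine ⟨F, hσF F fun d => ?_, fun l hl => J.rhoEquiv_eq_one fun y hy => ?_⟩
    · rw [hF1, ← neg_sub]
      exact neg_mem (apply_sub_mem_filt V hg' _ d)
    · rw [hF2 y (horth l hl y hy), sub_self]
      exact zero_mem _
  · rw [isFree_iff J, not_and_or] at hfree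
    have key : ∃ j, j ≠ i ∧ ¬ IsEven (J.form j) ∧ (j = i - 1 ∨ j = i + 1) := by
      rcases hfree with h | h
      · exact ⟨i - 1, by lia, h, Or.inl rfl⟩
      · exact ⟨i + 1, by lia, h, Or.inr rfl⟩
    obtain ⟨j, hji, hodd, hj⟩ := key
    obtain ⟨rfl, f, hf, ε, hε, hff⟩ := J.exists_isUnit_of_not_isEven hodd
    have e2 : ((2 : ℕ) : ℤ_[2]) = 2 := by norm_num
    have e3 : ((2 : ℤ_[2]) : ℚ_[2]) = 2 := rfl
    have hfj := J.component_le_scaledDual j hf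
    -- For j = i - 1 take (s, t) = (2, 1), for j = i + 1 take (1, 2). Either way s f vanishes in
    -- ρ_i(L), and the t-multiples that perturb L_j vanish in ρ_j(L).
    have hst : ∃ s t : ℤ_[2], s * t = 2 ∧
        (s : ℚ_[2]) * ((2 : ℕ) : ℚ_[2]) ^ j = t * ((2 : ℕ) : ℚ_[2]) ^ i ∧
        s • f ∈ filt q (i + 1) ∧ ∀ d, ∀ k : ℤ_[2], t • (V d + k • s • f) ∈ filt q (j + 1) := by
      have h20 : (2 : ℚ_[2]) ≠ 0 := two_ne_zero
      rcases hj with rfl | rfl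
      · refine ⟨2, 1, mul_one _, ?_, smul_mem_filt_of_dvd e2.dvd f, fun d k => ?_⟩
        · rw [e3, PadicInt.coe_one, one_mul, Nat.cast_ofNat, zpow_sub₀ h20, zpow_one]
          field_simp
        · rw [one_smul, sub_add_cancel]
          exact add_mem (Submodule.mem_sup_left (hVd d))
            (Submodule.smul_mem _ _ (smul_mem_filt_of_dvd e2.dvd f))
      · refine ⟨1, 2, one_mul _, ?_, ?_, fun d k => smul_mem_filt_of_dvd e2.dvd _⟩
        · rw [e3, PadicInt.coe_one, one_mul, Nat.cast_ofNat, zpow_add₀ h20, zpow_one, mul_comm]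
        · rw [one_smul]
          exact Submodule.mem_sup_left hfj
    obtain ⟨s, t, hst, hsj, hs, ht⟩ := hst
    simp only [e2] at hD
    obtain ⟨α, hα⟩ := exists_formDvd_sub_smul_vecMulVec hD hε
    rw [sub_right_comm] at hα
    obtain ⟨g', hg', hS'⟩ := exists_lift_isometry hS hSu hgu hε (by rwa [e2])
    obtain ⟨r, hr⟩ := (isUnit_of_p_dvd_sub (p_dvd_det_sub hg') hgu).exists_left_inv
    -- A unit of ℤ_2 is congruent to 1 modulo 2, so rescaling f by r is trivial on ρ_j(L).
    have hr1 : ((2 : ℕ) : ℤ_[2]) ∣ r - 1 := by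
      have h1 := two_dvd_sq_sub_self r
      have h2 : r * r - r = r * (r - 1) := by ring
      rwa [h2, (IsUnit.of_mul_eq_one _ hr).dvd_mul_left, ← e2] at h1
    obtain ⟨F, hF1, hF2⟩ := exists_isometry_of_frame_sup_line hq hSu hcV hc hfj hε hff
      (horth j hji f hf) hst hsj hS' hr
    refine ⟨F, hσF F fun d => ?_, fun l hl => J.rhoEquiv_eq_one fun y hy => ?_⟩
    · rw [hF1, ← neg_mem_iff, neg_sub, add_sub_right_comm]
      exact add_mem (apply_sub_mem_filt V hg' _ d) (Submodule.smul_mem _ _ hs)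
    · by_cases hlj : l = j
      · subst hlj
        obtain ⟨k, m, d, h1⟩ := (hF2 y (horth l hl y hy)).2
        rw [h1]
        exact add_mem (Submodule.smul_mem _ _ (smul_mem_filt_of_dvd hr1 f)) (ht d m)
      · rw [(hF2 y (horth l hl y hy)).1 (J.orthogonal l j hlj y hy f hf), sub_self]
        exact zero_mem _

theorem naturalHom_surjective (hq : IsNondegenerate q) :
    Function.Surjective (naturalHom q) := by
  classical
  obtain ⟨J⟩ := nonempty_jordanDecomposition hq
  intro σ
  have h1 : ∀ s : Finset ℤ, ∃ F : quadOrthogonalGroup q,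
      ∀ i, naturalHom q F i = if i ∈ s then σ i else 1 := by
    intro s
    induction s using Finset.induction_on with
    | empty => exact ⟨1, fun i => by rw [map_one]; rfl⟩
    | insert j s hj ih =>
      obtain ⟨F, hF⟩ := ih
      obtain ⟨F', hF1, hF2⟩ := J.exists_rhoEquiv_eq hq (σ j).2
      refine ⟨F' * F, fun i => ?_⟩
      rw [map_mul, Pi.mul_apply, hF]
      by_cases hij : i = j
      · subst hij
        rw [if_neg hj, if_pos (Finset.mem_insert_self _ _), mul_one]
        exact Subtype.ext hF1
      · have h2 : naturalHom q F' i = 1 := Subtype.ext (hF2 i hij)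
        rw [h2, one_mul]
        simp only [Finset.mem_insert, hij, false_or]
  -- Only finitely many constituents are nonzero; where L_i = 0 also ρ_i(L) = 0, so σ_i is the
  -- identity.
  obtain ⟨F, hF⟩ := h1 (WellFoundedGT.finite_ne_bot_of_iSupIndep
    J.isInternal.submodule_iSupIndep).toFinset
  refine ⟨F, funext fun i => (hF i).trans ?_⟩
  split_ifs with hi
  · rfl
  · rw [Set.Finite.mem_toFinset, Set.mem_ofPred_eq, not_not] at hi
    refine Subtype.ext ((J.rhoEquiv_eq fun x hx => ?_ : rhoEquiv q i 1 = _).symm.trans ?_).symm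
    · rw [hi, Submodule.mem_bot] at hx
      have h2 : x = 0 := Subtype.ext hx
      subst h2
      rw [map_zero, map_zero, eq_comm]
      exact rhoMap_one q i 0
    · exact LinearEquiv.ext fun x => rhoMap_one q i x

end Surjectivity

end PadicLattice

theorem mainTheorem4 {p : ℕ} [Fact p.Prime] {L : Type*} [AddCommGroup L] [Module ℤ_[p] L]
    [Module.Free ℤ_[p] L] [Module.Finite ℤ_[p] L] (q : QuadraticMap ℤ_[p] L ℚ_[p])
    (hq : PadicLattice.IsNondegenerate q) :
    Function.Surjective (PadicLattice.naturalHom q) :=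
  PadicLattice.naturalHom_surjective hq
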